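/- Let $H\in(0,1)$ and $\beta=\frac{1-2H}{2}\in(-\frac12,\frac12)$. For $\alpha>0$ and a function $g$ on $(0,T)$ let $${}_0\partial_t^{-\alpha}g(t)=\frac1{\Gamma(\alpha)}\int_0^t(t-\xi)^{\alpha-1}g(\xi)\,d\xi$$ be the left-sided Riemann–Liouville integral. The left-sided Riemann–Liouville derivative ${}_0\partial_t^{\beta}g$ is $\partial_t\bigl({}_0\partial_t^{\beta-1}g\bigr)$, with $\partial_t$ the weak derivative on $(0,T)$, if $\beta>0$; it is $g$ if $\beta=0$, and the fractional integral of order $-\beta$ if $\beta<0$. A one-dimensional fractional Brownian motion with Hurst index $H$ is a centred Gaussian process $(W^H(t))_{t\ge0}$ on a probability space with $\mathbb E[W^H(s)W^H(t)]=\frac12\bigl(s^{2H}+t^{2H}-|t-s|^{2H}\bigr)$. For a step function $f=\sum_i c_i\mathbf 1_{(l_i,r_i]}$ on $[0,T]$ put $\int_0^Tf\,dW^H=\sum_ic_i(W^H(r_i)-W^H(l_i))$. For deterministic $g\in L^2(0,T)$, the integral $\int_0^Tg\,dW^H$ is defined as the limit in $L^2(\Omega)$ of $\int_0^Tf_k\,dW^H$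 for step functions $f_k\to g$ in $L^2(0,T)$ whose integrals converge in $L^2(\Omega)$, whenever such $f_k$ exist. **Lemma.** For every $H\in(0,1)$ there is a constant $C>0$, depending only on $H$, such that for every $T>0$, every fractional Brownian motion $W^H$ with Hurst index $H$, and every deterministic $g\in L^2(0,T)$ with ${}_0\partial_t^{\frac{1-2H}{2}}g\in L^2(0,T)$, the integrals $\int_0^Tg(r)\,dW^H(r)$ and $\int_0^Tg(T-r)\,dW^H(r)$ exist and every version of them satisfies $$\mathbb E\Bigl(\int_0^Tg(r)\,dW^H(r)\Bigr)^2\le C\,\bigl\|{}_0\partial_t^{\frac{1-2H}{2}}g\bigr\|_{L^2(0,T)}^2,$$ $$\mathbb E\Bigl(\int_0^Tg(T-r)\,dW^H(r)\Bigr)^2\le C\,\bigl\|{}_0\partial_t^{\frac{1-2H}{2}}g\bigr\|_{L^2(0,T)}^2.$$ -/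

import Mathlib

open MeasureTheory ProbabilityTheory Filter Topology
open scoped NNReal ENNReal

namespace FBM

/-- The left-sided Riemann-Liouville fractional integral of order `α > 0` with base point `a`. -/
noncomputable def rlIntegral (a α : ℝ) (u : ℝ → ℝ) (x : ℝ) : ℝ :=
  (1 / Real.Gamma α) * ∫ ξ in a..x, (x - ξ) ^ (α - 1) * u ξ

/-- `w` is the weak (distributional) derivative of `v` on the open interval `(a, b)`: both are
locally integrable there, and integration by parts holds against every smooth test function with
compact support in `(a, b)`. -/
structure HasWeakDerivOn (a b : ℝ) (v w : ℝ → ℝ) : Prop where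
  locallyIntegrableOn_fun : LocallyIntegrableOn v (Set.Ioo a b)
  locallyIntegrableOn_deriv : LocallyIntegrableOn w (Set.Ioo a b)
  integral_eq : ∀ η : ℝ → ℝ, ContDiff ℝ (⊤ : ℕ∞) η → HasCompactSupport η → tsupport η ⊆ Set.Ioo a b →
    ∫ x in Set.Ioo a b, v x * deriv η x = -∫ x in Set.Ioo a b, w x * η x

/-- For `β < 1`: on `(0, T)`, `φ` is (almost everywhere) the left-sided Riemann-Liouville
derivative of order `β` of `u` with base point `0`.
For `0 < β < 1` it is the derivative, in the weak sense, of the fractional integral of order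
`1 - β`; for `β = 0` it is `u` itself; for `β < 0` it is the fractional integral of
order `-β`. -/
def HasRLDeriv (T β : ℝ) (u φ : ℝ → ℝ) : Prop :=
  (0 < β → HasWeakDerivOn 0 T (rlIntegral 0 (1 - β) u) φ) ∧
  (β = 0 → φ =ᵐ[volume.restrict (Set.Ioo 0 T)] u) ∧
  (β < 0 → φ =ᵐ[volume.restrict (Set.Ioo 0 T)] rlIntegral 0 (-β) u)

/-- `W` is a one-dimensional (normalized) fractional Brownian motion with Hurst index `H`: a
centred Gaussian process on `[0, ∞)` with covariance
`E[W_s W_t] = (s^{2H} + t^{2H} - |t - s|^{2H}) / 2`. (Continuity of paths is not required.) -/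
structure IsFBM {Ω : Type*} [MeasurableSpace Ω] (H : ℝ) (W : ℝ≥0 → Ω → ℝ) (P : Measure Ω) :
    Prop where
  isGaussianProcess : IsGaussianProcess W P
  centered : ∀ t, ∫ ω, W t ω ∂P = 0
  covariance : ∀ s t : ℝ≥0, ∫ ω, W s ω * W t ω ∂P =
    ((s : ℝ) ^ (2 * H) + (t : ℝ) ^ (2 * H) - |(t : ℝ) - (s : ℝ)| ^ (2 * H)) / 2

/-- A step function on `[0, T]`, given as `∑ i, c i • 1_{(l i, r i]}` with `0 ≤ l i ≤ r i ≤ T`. -/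
structure StepFunction (T : ℝ) where
  n : ℕ
  c : Fin n → ℝ
  l : Fin n → ℝ≥0
  r : Fin n → ℝ≥0
  l_le_r : ∀ i, l i ≤ r i
  r_le : ∀ i, (r i : ℝ) ≤ T

/-- The function `∑ i, c i • 1_{(l i, r i]}`. -/
noncomputable def StepFunction.toFun {T : ℝ} (f : StepFunction T) (x : ℝ) : ℝ :=
  ∑ i, (Set.Ioc (f.l i : ℝ) (f.r i)).indicator (fun _ ↦ f.c i) x

/-- The elementary stochastic integral `∑ i, c i (W (r i) - W (l i))` of a step function. -/
def StepFunction.integral {T : ℝ} {Ω : Type*} (f : StepFunction T) (W : ℝ≥0 → Ω → ℝ) (ω : Ω) : ℝ :=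
  ∑ i, f.c i * (W (f.r i) ω - W (f.l i) ω)

/-- The random variable `X` is (a version of) the Wiener integral `∫₀ᵀ g dW` of the deterministic
function `g ∈ L²(0, T)`: there are step functions `f k` with `f k → g` in `L²(0, T)` whose
elementary integrals converge to `X` in `L²(Ω)`. In other words, the Wiener integral is the closure
of the elementary integral, as an operator from `L²(0, T)` to `L²(Ω)`. For a fractional Brownian
motion the elementary integral is bounded for the `L²(0, T)` norm if `1/2 ≤ H`, and for `H < 1/2`
the `L²(0, T)` norm is controlled by the `L²(Ω)` norm of the elementary integral; so this is the
usual extension of the elementary integral by completion, restricted to integrands in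
`L²(0, T)`. -/
def IsWienerIntegral {Ω : Type*} [MeasurableSpace Ω] (P : Measure Ω) (W : ℝ≥0 → Ω → ℝ) (T : ℝ)
    (g : ℝ → ℝ) (X : Ω → ℝ) : Prop :=
  MemLp g 2 (volume.restrict (Set.Ioo 0 T)) ∧ MemLp X 2 P ∧
  ∃ f : ℕ → StepFunction T,
    Tendsto (fun k ↦ eLpNorm (fun x ↦ (f k).toFun x - g x) 2 (volume.restrict (Set.Ioo 0 T)))
      atTop (𝓝 0) ∧
    Tendsto (fun k ↦ eLpNorm (fun ω ↦ (f k).integral W ω - X ω) 2 P) atTop (𝓝 0)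

end FBM

/-! Write $k_a(x)=x_+^{a-1}/\Gamma(a)$ and $a=H+\frac12=1-\beta$. For a step function $f$ on $[0,T]$
the left-sided derivative $F$ of order $\beta$ replaces $\mathbf 1_{(l,r]}$ by $k_a(t-l)-k_a(t-r)$,
and the right-sided derivative $B$ replaces it by $k_a(r-t)-k_a(l-t)$. The proof compares three
quadratic quantities, each determined by its values on single increments (`integral_comb_mul_comb`).
With $S=\mathbb E(\int f\,dW^H)^2$, the energy of $f$ for the variogram $|x-y|^{2H}$, one has
$\int_{\mathbb R}B^2=\kappa S$ (Mandelbrot-Van Ness) and $\int_0^TFB=S/\Gamma(2H+1)$ (semigroup law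
$k_a*k_a=k_{2a}$). By Cauchy-Schwarz, $S/\Gamma(2H+1)\le\|F\|_{L^2(0,T)}\sqrt{\kappa S}$, hence
$S\le\kappa\,\Gamma(2H+1)^2\|F\|^2_{L^2(0,T)}$. This is `energy_le`; its constant does not involve
$T$.

To pass to general $g$, step functions must converge to $g$ while their derivatives converge to
$\varphi$ (`HasRLDeriv.exists_tendsto`). For $H\ge\frac12$ the map $g\mapsto\varphi$ is bounded on
$L^2$, and density of step functions suffices. For $H<\frac12$ the derivatives of step functions are
dense in $L^2$, because only zero is orthogonal to all $k_a(\cdot-l)$. A weak derivative in $L^2$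
forces $g$ to be the fractional integral of $\varphi$, so the boundedness of that integral brings
the convergence back to $g$ (`HasRLDeriv.ae_eq_rlConv`).

The bound for every version needs uniqueness of the integral, that is, closability of the elementary
integral (`ae_eq_zero_of_tendsto`): if $f_k\to0$ and the integrals converge, then $B_k$ converges in
$L^2(\mathbb R)$, and fractional integration by parts identifies the limit as zero. The second
inequality follows because the energy is invariant under $r\mapsto T-r$. -/

namespace FBM

/-! ### Riemann-Liouville kernels and their semigroup law -/

/-- The Riemann-Liouville kernel `x₊ ^ (a - 1) / Γ(a)`. -/
noncomputable def rlKernel (a x : ℝ) : ℝ := if 0 < x then x ^ (a - 1) / Real.Gamma a else 0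

/-- The convolution of `u` with the Riemann-Liouville kernel of order `a`. -/
noncomputable def rlConv (a : ℝ) (u : ℝ → ℝ) (x : ℝ) : ℝ := ∫ ξ, rlKernel a (x - ξ) * u ξ

lemma rlKernel_of_pos {a x : ℝ} (hx : 0 < x) : rlKernel a x = x ^ (a - 1) / Real.Gamma a :=
  if_pos hx

lemma rlKernel_of_nonpos {a x : ℝ} (hx : x ≤ 0) : rlKernel a x = 0 := if_neg hx.not_gt

lemma rlKernel_nonneg {a : ℝ} (ha : 0 < a) (x : ℝ) : 0 ≤ rlKernel a x := by
  unfold rlKernel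
  split_ifs with h
  · have := Real.Gamma_pos_of_pos ha
    positivity
  · exact le_rfl

lemma rlKernel_one (x : ℝ) : rlKernel 1 x = (Set.Ioi (0 : ℝ)).indicator 1 x := by
  simp [rlKernel, Set.indicator]

@[fun_prop]
lemma measurable_rlKernel (a : ℝ) : Measurable (rlKernel a) :=
  Measurable.ite measurableSet_Ioi (by fun_prop) measurable_const

lemma rlKernel_mul {a c : ℝ} (hc : 0 < c) (x : ℝ) :
    rlKernel a (c * x) = c ^ (a - 1) * rlKernel a x := by
  by_cases hx : 0 < x
  · rw [rlKernel_of_pos (mul_pos hc hx), rlKernel_of_pos hx, Real.mul_rpow hc.le hx.le]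
    ring
  · rw [rlKernel_of_nonpos (not_lt.1 hx), mul_zero, rlKernel_of_nonpos]
    exact mul_nonpos_of_nonneg_of_nonpos hc.le (not_lt.1 hx)

lemma integrable_betaPDFReal {a b : ℝ} (ha : 0 < a) (hb : 0 < b) :
    Integrable (betaPDFReal a b) ∧ ∫ x, betaPDFReal a b x = 1 := by
  have h0 : ∀ x, 0 ≤ betaPDFReal a b x := fun x ↦ by
    by_cases hx : 0 < x ∧ x < 1
    · exact (betaPDFReal_pos hx.1 hx.2 ha hb).le
    · simp [betaPDFReal, hx]
  have h1 : ∫⁻ x, ENNReal.ofReal (betaPDFReal a b x) = 1 := lintegral_betaPDF_eq_one ha hb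
  have hm : Measurable (betaPDFReal a b) := by
    unfold betaPDFReal
    exact Measurable.ite measurableSet_Ioo (by fun_prop) measurable_const
  have hi : Integrable (betaPDFReal a b) :=
    ⟨hm.aestronglyMeasurable, by
      rw [hasFiniteIntegral_iff_ofReal (ae_of_all _ h0), h1]; simp⟩
  refine ⟨hi, ?_⟩
  rw [integral_eq_lintegral_of_nonneg_ae (ae_of_all _ h0) hi.1, h1]
  simp

/-- After rescaling to the unit interval, the integrand of $k_a*k_b$ is the Beta density up to the
factor $1/\Gamma(a+b)$. The normalization of that density then evaluates the convolution. -/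
lemma rlKernel_one_sub_mul {a b : ℝ} (ha : 0 < a) (hb : 0 < b) (w : ℝ) :
    rlKernel a (1 - w) * rlKernel b w = (1 / Real.Gamma (a + b)) * betaPDFReal b a w := by
  have h1 := (Real.Gamma_pos_of_pos ha).ne'
  have h2 := (Real.Gamma_pos_of_pos hb).ne'
  have h3 := (Real.Gamma_pos_of_pos (add_pos ha hb)).ne'
  by_cases h : 0 < w ∧ w < 1
  · rw [rlKernel_of_pos (by linarith), rlKernel_of_pos h.1, betaPDFReal, if_pos h, beta,
      add_comm b a]
    field_simp
  · rw [betaPDFReal, if_neg h]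
    by_cases hw : 0 < w
    · rw [rlKernel_of_nonpos (x := 1 - w)]
      · simp
      · have : ¬ w < 1 := fun h' ↦ h ⟨hw, h'⟩
        linarith
    · rw [rlKernel_of_nonpos (not_lt.1 hw)]
      simp

/-- The convolution of the Riemann-Liouville kernels of orders `a` and `b` is the one of order
`a + b`. -/
lemma integral_rlKernel_mul_rlKernel {a b : ℝ} (ha : 0 < a) (hb : 0 < b) (x r : ℝ) :
    Integrable (fun z ↦ rlKernel a (x - z) * rlKernel b (z - r)) ∧
      ∫ z, rlKernel a (x - z) * rlKernel b (z - r) = rlKernel (a + b) (x - r) := by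
  rcases le_or_gt x r with h | h
  · have : (fun z ↦ rlKernel a (x - z) * rlKernel b (z - r)) = fun _ ↦ 0 := by
      ext z
      rcases le_or_gt x z with h' | h'
      · rw [rlKernel_of_nonpos (by linarith), zero_mul]
      · rw [rlKernel_of_nonpos (a := b) (by linarith), mul_zero]
    rw [this, rlKernel_of_nonpos (by linarith)]
    simp
  · set c := x - r with hc
    have hc0 : 0 < c := by linarith
    set f : ℝ → ℝ := fun w ↦ c ^ (a - 1) * c ^ (b - 1) * ((1 / Real.Gamma (a + b)) *
      betaPDFReal b a w) with hf
    obtain ⟨h1, h2⟩ := integrable_betaPDFReal hb ha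
    have hfi : Integrable f := (h1.const_mul _).const_mul _
    have hff : ∫ w, f w = c ^ (a - 1) * c ^ (b - 1) * (1 / Real.Gamma (a + b)) := by
      rw [hf, integral_const_mul, integral_const_mul, h2, mul_one]
    have key : (fun z ↦ rlKernel a (x - z) * rlKernel b (z - r)) =
        fun z ↦ f (c⁻¹ * (z - r)) := by
      ext z
      have e1 : x - z = c * (1 - c⁻¹ * (z - r)) := by field_simp; rw [hc]; ring
      have e2 : z - r = c * (c⁻¹ * (z - r)) := by field_simp
      rw [e1]
      nth_rewrite 2 [e2]
      rw [rlKernel_mul hc0, rlKernel_mul hc0, hf]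
      simp only
      rw [← rlKernel_one_sub_mul ha hb]
      ring
    rw [key]
    constructor
    · exact (hfi.comp_mul_left' (inv_ne_zero hc0.ne')).comp_sub_right r
    · rw [integral_sub_right_eq_self (fun z ↦ f (c⁻¹ * z)) r, Measure.integral_comp_mul_left,
        hff, rlKernel_of_pos hc0, inv_inv, abs_of_pos hc0, smul_eq_mul,
        show a + b - 1 = (a - 1) + (b - 1) + 1 by ring, Real.rpow_add hc0, Real.rpow_add hc0,
        Real.rpow_one]
      ring

lemma integrableOn_rlKernel {a : ℝ} (ha : 0 < a) (c d : ℝ) :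
    IntegrableOn (rlKernel a) (Set.Ioc c d) := by
  have h1 : IntegrableOn (fun x : ℝ ↦ x ^ (a - 1) / Real.Gamma a) (Set.Ioc c d) :=
    ((intervalIntegral.intervalIntegrable_rpow' (a := c) (b := d)
      (by linarith : -1 < a - 1)).div_const _).1
  have h2 : rlKernel a = (Set.Ioi 0).indicator fun x : ℝ ↦ x ^ (a - 1) / Real.Gamma a := by
    ext x
    simp [rlKernel, Set.indicator]
  rw [h2]
  exact h1.indicator measurableSet_Ioi

/-- Squaring doubles the exponent $a-1$, which corresponds to order $2a-1$. Local square
integrability is thus local integrability at a positive order, whence the threshold $a>1/2$, that is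
$H>0$ when $a=H+1/2$. -/
lemma rlKernel_sq {a : ℝ} (ha : 1 / 2 < a) (x : ℝ) :
    rlKernel a x ^ 2 = Real.Gamma (2 * a - 1) / Real.Gamma a ^ 2 * rlKernel (2 * a - 1) x := by
  rcases le_or_gt x 0 with h | h
  · simp [rlKernel_of_nonpos h]
  · have h1 := (Real.Gamma_pos_of_pos (show 0 < a by linarith)).ne'
    have h2 := (Real.Gamma_pos_of_pos (show 0 < 2 * a - 1 by linarith)).ne'
    rw [rlKernel_of_pos h, rlKernel_of_pos h, div_pow, ← Real.rpow_mul_natCast h.le,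
      show (a - 1) * ((2 : ℕ) : ℝ) = 2 * a - 1 - 1 by push_cast; ring]
    field_simp

lemma memLp_rlKernel {a : ℝ} (ha : 1 / 2 < a) (c d : ℝ) :
    MemLp (rlKernel a) 2 (volume.restrict (Set.Ioc c d)) := by
  rw [memLp_two_iff_integrable_sq (measurable_rlKernel a).aestronglyMeasurable]
  simp_rw [rlKernel_sq ha]
  exact (integrableOn_rlKernel (by linarith) c d).const_mul _

/-! ### Boundedness of fractional integration on $L^2(0,T)$ -/

/-- Young's inequality for the convolution of `L¹` with `L²`. -/
lemma lintegral_conv_sq_le {K U : ℝ → ℝ≥0∞} (hK : Measurable K) (hU : AEMeasurable U) :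
    ∫⁻ x, (∫⁻ ξ, K (x - ξ) * U ξ) ^ 2 ≤ (∫⁻ x, K x) ^ 2 * ∫⁻ ξ, U ξ ^ 2 := by
  have key : ∀ x, (∫⁻ ξ, K (x - ξ) * U ξ) ^ 2 ≤
      (∫⁻ x, K x) * ∫⁻ ξ, K (x - ξ) * U ξ ^ 2 := fun x ↦ by
    -- Cauchy-Schwarz for the splitting $KU=K^{1/2}\cdot K^{1/2}U$.
    have h := ENNReal.lintegral_mul_le_Lp_mul_Lq volume Real.HolderConjugate.two_two
      (f := fun ξ ↦ K (x - ξ) ^ (1 / 2 : ℝ)) (g := fun ξ ↦ K (x - ξ) ^ (1 / 2 : ℝ) * U ξ)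
      (by fun_prop) (by fun_prop)
    have e1 : ∀ ξ, K (x - ξ) ^ (1 / 2 : ℝ) * (K (x - ξ) ^ (1 / 2 : ℝ) * U ξ) =
        K (x - ξ) * U ξ := fun ξ ↦ by
      rw [← mul_assoc, ← ENNReal.rpow_add_of_nonneg _ _ (by norm_num) (by norm_num)]
      norm_num
    have e2 : ∀ y : ℝ≥0∞, (y ^ (1 / 2 : ℝ)) ^ (2 : ℝ) = y := fun y ↦ by
      rw [← ENNReal.rpow_mul]; norm_num
    simp only [Pi.mul_apply, e1, e2, ENNReal.mul_rpow_of_nonneg _ _ (zero_le_two (α := ℝ))] at h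
    have h' := pow_le_pow_left₀ (zero_le (a := ∫⁻ ξ, K (x - ξ) * U ξ)) h 2
    rw [mul_pow, ← ENNReal.rpow_two, ← ENNReal.rpow_two, ← ENNReal.rpow_two, e2, e2] at h'
    rw [lintegral_sub_left_eq_self (fun ξ ↦ K ξ) x] at h'
    simpa using h'
  calc ∫⁻ x, (∫⁻ ξ, K (x - ξ) * U ξ) ^ 2
      ≤ ∫⁻ x, (∫⁻ x, K x) * ∫⁻ ξ, K (x - ξ) * U ξ ^ 2 := lintegral_mono key
    _ = (∫⁻ x, K x) * ∫⁻ x, ∫⁻ ξ, K (x - ξ) * U ξ ^ 2 := by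
        have : AEMeasurable (fun p : ℝ × ℝ ↦ K (p.1 - p.2) * U p.2 ^ 2)
            (volume.prod volume) :=
          (hK.comp (by fun_prop)).aemeasurable.mul ((hU.pow_const 2).comp_quasiMeasurePreserving
            Measure.quasiMeasurePreserving_snd)
        exact lintegral_const_mul'' _ this.lintegral_prod_right'
    _ = (∫⁻ x, K x) * ∫⁻ ξ, ∫⁻ x, K (x - ξ) * U ξ ^ 2 := by
        rw [lintegral_lintegral_swap]
        exact (hK.comp (by fun_prop)).aemeasurable.mul
          ((hU.pow_const 2).comp_quasiMeasurePreserving Measure.quasiMeasurePreserving_snd)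
    _ = (∫⁻ x, K x) * ∫⁻ ξ, (∫⁻ x, K x) * U ξ ^ 2 := by
        congr 1
        refine lintegral_congr fun ξ ↦ ?_
        rw [lintegral_mul_const _ (by fun_prop), lintegral_sub_right_eq_self (fun x ↦ K x) ξ]
    _ = _ := by
        rw [lintegral_const_mul'' _ (hU.pow_const 2), ← mul_assoc, sq]

lemma rlConv_congr {a x : ℝ} {u v : ℝ → ℝ} (h : ∀ᵐ ξ, ξ < x → u ξ = v ξ) :
    rlConv a u x = rlConv a v x := by
  refine integral_congr_ae (h.mono fun ξ hξ ↦ ?_)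
  simp only
  rcases lt_or_ge ξ x with h' | h'
  · rw [hξ h']
  · rw [rlKernel_of_nonpos (by linarith), zero_mul, zero_mul]

lemma rlConv_of_nonpos {a x : ℝ} {u : ℝ → ℝ} (h0 : ∀ ξ ≤ 0, u ξ = 0) (hx : x ≤ 0) :
    rlConv a u x = 0 := by
  rw [rlConv_congr (v := fun _ ↦ 0)]
  · simp [rlConv]
  · exact ae_of_all _ fun ξ hξ ↦ h0 ξ (by linarith)

lemma rlConv_eq_rlIntegral {a x : ℝ} {u : ℝ → ℝ} (h0 : ∀ ξ ≤ 0, u ξ = 0) (hx : 0 ≤ x) :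
    rlConv a u x = rlIntegral 0 a u x := by
  rw [rlIntegral, intervalIntegral.integral_of_le hx, integral_Ioc_eq_integral_Ioo,
    ← integral_indicator measurableSet_Ioo, ← integral_const_mul, rlConv]
  congr 1
  ext ξ
  by_cases h : ξ ∈ Set.Ioo 0 x
  · rw [Set.indicator_of_mem h, rlKernel_of_pos (by linarith [h.2])]
    ring
  · rw [Set.indicator_of_notMem h, mul_zero]
    rcases le_or_gt ξ 0 with h' | h'
    · rw [h0 ξ h', mul_zero]
    · rw [rlKernel_of_nonpos, zero_mul]
      by_contra h2
      exact h ⟨h', by linarith⟩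

lemma rlConv_one {x : ℝ} {u : ℝ → ℝ} (h0 : ∀ ξ ≤ 0, u ξ = 0) (hx : 0 ≤ x) :
    rlConv 1 u x = ∫ ξ in 0..x, u ξ := by
  rw [rlConv_eq_rlIntegral h0 hx]
  simp [rlIntegral]

section

variable {T : ℝ} {u : ℝ → ℝ}

/-- Truncation to `(0, T)` does not change the convolution before time `T`. -/
lemma ae_eq_indicator_of_lt {x : ℝ} (h0 : ∀ ξ ≤ 0, u ξ = 0) (hx : x ≤ T) :
    ∀ᵐ ξ, ξ < x → u ξ = (Set.Ioo 0 T).indicator u ξ := by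
  refine ae_of_all _ fun ξ hξ ↦ ?_
  rcases le_or_gt ξ 0 with h | h
  · rw [h0 ξ h, Set.indicator_of_notMem]
    simp [h]
  · rw [Set.indicator_of_mem]
    exact ⟨h, by linarith⟩

lemma aestronglyMeasurable_rlConv {a : ℝ} (h0 : ∀ ξ ≤ 0, u ξ = 0)
    (hu : AEStronglyMeasurable u (volume.restrict (Set.Ioo 0 T))) :
    AEStronglyMeasurable (rlConv a u) (volume.restrict (Set.Ioo 0 T)) := by
  have hu' := (aestronglyMeasurable_indicator_iff (measurableSet_Ioo (a := (0 : ℝ)) (b := T))).2 hu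
  have h1 : AEStronglyMeasurable (rlConv a ((Set.Ioo 0 T).indicator u)) := by
    have : AEStronglyMeasurable (fun p : ℝ × ℝ ↦
        rlKernel a (p.1 - p.2) * (Set.Ioo 0 T).indicator u p.2) (volume.prod volume) :=
      ((measurable_rlKernel a).comp (by fun_prop)).aestronglyMeasurable.mul
        (hu'.comp_quasiMeasurePreserving Measure.quasiMeasurePreserving_snd)
    exact this.integral_prod_right'
  refine h1.restrict.congr (ae_restrict_of_forall_mem measurableSet_Ioo fun x hx ↦ ?_)
  exact (rlConv_congr (ae_eq_indicator_of_lt h0 hx.2.le)).symm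

/-- For $x<T$ the convolution sees the kernel and $u$ only on $(0,T)$. Both can be truncated, and
Young's inequality applies although the kernel is not integrable on the half-line. -/
lemma lintegral_rlConv_le {a : ℝ} (h0 : ∀ ξ ≤ 0, u ξ = 0)
    (hu : AEStronglyMeasurable u (volume.restrict (Set.Ioo 0 T))) :
    ∫⁻ x in Set.Ioo 0 T, (∫⁻ ξ, ‖rlKernel a (x - ξ) * u ξ‖ₑ) ^ 2 ≤
      (∫⁻ x in Set.Ioo 0 T, ‖rlKernel a x‖ₑ) ^ 2 * ∫⁻ x in Set.Ioo 0 T, ‖u x‖ₑ ^ 2 := by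
  have hm := measurableSet_Ioo (a := (0 : ℝ)) (b := T)
  have hU : AEMeasurable (fun ξ ↦ ‖(Set.Ioo 0 T).indicator u ξ‖ₑ) :=
    ((aestronglyMeasurable_indicator_iff hm).2 hu).enorm
  have h := lintegral_conv_sq_le (K := (Set.Ioo 0 T).indicator fun x ↦ ‖rlKernel a x‖ₑ)
    ((by fun_prop : Measurable fun x ↦ ‖rlKernel a x‖ₑ).indicator hm) hU
  rw [lintegral_indicator hm] at h
  have e : ∀ ξ, ‖(Set.Ioo 0 T).indicator u ξ‖ₑ ^ 2 =
      (Set.Ioo 0 T).indicator (fun ξ ↦ ‖u ξ‖ₑ ^ 2) ξ := fun ξ ↦ by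
    by_cases hξ : ξ ∈ Set.Ioo 0 T <;> simp [hξ]
  simp_rw [e] at h
  rw [lintegral_indicator hm] at h
  refine le_trans ?_ ((setLIntegral_le_lintegral (Set.Ioo 0 T) _).trans h)
  refine setLIntegral_mono' hm fun x hx ↦ ?_
  gcongr with ξ
  rcases le_or_gt ξ 0 with h1 | h1
  · simp [h0 ξ h1]
  rcases le_or_gt x ξ with h2 | h2
  · simp [rlKernel_of_nonpos (sub_nonpos.2 h2)]
  rw [Set.indicator_of_mem, Set.indicator_of_mem, enorm_mul]
  · exact ⟨h1, h2.trans hx.2⟩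
  · exact ⟨by linarith, by linarith [hx.2]⟩

lemma lintegral_rlKernel_lt_top {a : ℝ} (ha : 0 < a) (T : ℝ) :
    ∫⁻ x in Set.Ioo 0 T, ‖rlKernel a x‖ₑ < ∞ :=
  ((integrableOn_rlKernel ha 0 T).mono_set Set.Ioo_subset_Ioc_self).2

lemma eLpNorm_two_sq {α : Type*} [MeasurableSpace α] (μ : Measure α) (f : α → ℝ) :
    eLpNorm f 2 μ ^ 2 = ∫⁻ x, ‖f x‖ₑ ^ 2 ∂μ := by
  rw [eLpNorm_eq_lintegral_rpow_enorm_toReal two_ne_zero ENNReal.ofNat_ne_top,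
    ← ENNReal.rpow_two, ← ENNReal.rpow_mul]
  simp

/-- The Riemann-Liouville integral is bounded on `L²(0, T)`. -/
lemma eLpNorm_rlConv_le {a : ℝ} (h0 : ∀ ξ ≤ 0, u ξ = 0)
    (hu : AEStronglyMeasurable u (volume.restrict (Set.Ioo 0 T))) :
    eLpNorm (rlConv a u) 2 (volume.restrict (Set.Ioo 0 T)) ≤
      (∫⁻ x in Set.Ioo 0 T, ‖rlKernel a x‖ₑ) *
        eLpNorm u 2 (volume.restrict (Set.Ioo 0 T)) := by
  rw [← ENNReal.pow_le_pow_left_iff two_ne_zero, mul_pow, eLpNorm_two_sq, eLpNorm_two_sq]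
  refine le_trans (lintegral_mono fun x ↦ ?_) (lintegral_rlConv_le h0 hu)
  gcongr
  exact enorm_integral_le_lintegral_enorm _

lemma memLp_rlConv {a : ℝ} (ha : 0 < a) (h0 : ∀ ξ ≤ 0, u ξ = 0)
    (hu : MemLp u 2 (volume.restrict (Set.Ioo 0 T))) :
    MemLp (rlConv a u) 2 (volume.restrict (Set.Ioo 0 T)) :=
  ⟨aestronglyMeasurable_rlConv h0 hu.1, (eLpNorm_rlConv_le h0 hu.1).trans_lt
    (ENNReal.mul_lt_top (lintegral_rlKernel_lt_top ha T) hu.2)⟩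

lemma ae_integrable_rlConv {a : ℝ} (ha : 0 < a) (h0 : ∀ ξ ≤ 0, u ξ = 0)
    (hu : MemLp u 2 (volume.restrict (Set.Ioo 0 T))) :
    ∀ᵐ x ∂volume.restrict (Set.Ioo 0 T), Integrable fun ξ ↦ rlKernel a (x - ξ) * u ξ := by
  have hm := measurableSet_Ioo (a := (0 : ℝ)) (b := T)
  have h1 := (lintegral_rlConv_le (a := a) h0 hu.1).trans_lt (ENNReal.mul_lt_top
    (ENNReal.pow_lt_top (n := 2) (lintegral_rlKernel_lt_top ha T))
    (by rw [← eLpNorm_two_sq]; exact ENNReal.pow_lt_top hu.2))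
  have hu' := (aestronglyMeasurable_indicator_iff hm).2 hu.1
  have e : ∀ x ∈ Set.Ioo 0 T, (fun ξ ↦ rlKernel a (x - ξ) * u ξ) =
      fun ξ ↦ rlKernel a (x - ξ) * (Set.Ioo 0 T).indicator u ξ := fun x hx ↦ by
    ext ξ
    rcases le_or_gt ξ 0 with h1 | h1
    · simp [h0 ξ h1, Set.indicator, h1.not_gt]
    rcases le_or_gt x ξ with h2 | h2
    · simp [rlKernel_of_nonpos (sub_nonpos.2 h2)]
    rw [Set.indicator_of_mem]
    exact ⟨h1, h2.trans hx.2⟩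
  have hmeas : AEMeasurable (fun x ↦ (∫⁻ ξ, ‖rlKernel a (x - ξ) * u ξ‖ₑ) ^ 2)
      (volume.restrict (Set.Ioo 0 T)) := by
    have : AEStronglyMeasurable (fun p : ℝ × ℝ ↦
        rlKernel a (p.1 - p.2) * (Set.Ioo 0 T).indicator u p.2) (volume.prod volume) :=
      ((measurable_rlKernel a).comp (by fun_prop)).aestronglyMeasurable.mul
        (hu'.comp_quasiMeasurePreserving Measure.quasiMeasurePreserving_snd)
    refine (this.enorm.lintegral_prod_right'.pow_const 2).restrict.congr
      (ae_restrict_of_forall_mem hm fun x hx ↦ ?_)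
    have h2 : ∀ ξ, rlKernel a (x - ξ) * u ξ =
        rlKernel a (x - ξ) * (Set.Ioo 0 T).indicator u ξ := congrFun (e x hx)
    simp only [h2]
  filter_upwards [ae_lt_top' hmeas h1.ne, ae_restrict_mem hm] with x hx hxT
  refine ⟨?_, ?_⟩
  · rw [e x hxT]
    exact ((measurable_rlKernel a).comp (by fun_prop)).aestronglyMeasurable.mul hu'
  · exact (ENNReal.pow_lt_top_iff.1 hx).resolve_right two_ne_zero

end

/-! ### Injectivity of fractional integration -/

lemma ae_eq_zero_of_intervalIntegral_eq_zero {T : ℝ} {u : ℝ → ℝ}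
    (hu : IntegrableOn u (Set.Ioo 0 T)) (h : ∀ x ∈ Set.Ioo 0 T, ∫ s in 0..x, u s = 0) :
    ∀ᵐ x ∂volume.restrict (Set.Ioo 0 T), u x = 0 := by
  rcases le_or_gt T 0 with hT | hT
  · simp [Set.Ioo_eq_empty hT.not_gt]
  have hu' : IntervalIntegrable u volume 0 T :=
    (intervalIntegrable_iff_integrableOn_Ioo_of_le hT.le).2 hu
  rw [ae_restrict_iff' measurableSet_Ioo]
  filter_upwards [hu'.ae_hasDerivAt_integral] with x hx hxT
  have hx1 : x ∈ Set.uIcc 0 T := by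
    rw [Set.uIcc_of_le hT.le]
    exact Set.Ioo_subset_Icc_self hxT
  have h1 := hx hx1 0 Set.left_mem_uIcc
  have h2 : (fun x ↦ ∫ t in (0 : ℝ)..x, u t) =ᶠ[𝓝 x] fun _ ↦ 0 := by
    filter_upwards [isOpen_Ioo.mem_nhds hxT] with y hy using h y hy
  exact (h1.congr_of_eventuallyEq h2.symm).unique (hasDerivAt_const x (0 : ℝ))

/-- The semigroup property of Riemann-Liouville integrals, for orders summing to `1`. -/
lemma rlConv_rlConv {T a b : ℝ} {u : ℝ → ℝ} (ha : 0 < a) (hb : 0 < b) (hab : a + b = 1)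
    (h0 : ∀ ξ ≤ 0, u ξ = 0) (hu : IntegrableOn u (Set.Ioo 0 T)) {x : ℝ} (hx : x ≤ T) :
    rlConv a (rlConv b u) x = rlConv 1 u x := by
  set w := (Set.Ioo 0 T).indicator u with hw
  have hwi : Integrable w := (integrable_indicator_iff measurableSet_Ioo).2 hu
  have e1 : rlConv a (rlConv b u) x = rlConv a (rlConv b w) x :=
    rlConv_congr (ae_of_all _ fun z hz ↦ rlConv_congr (ae_eq_indicator_of_lt h0 (hz.le.trans hx)))
  rw [e1, rlConv_congr (a := 1) (ae_eq_indicator_of_lt h0 hx), ← hw]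
  have hk1 : ∀ y, rlKernel 1 y ≤ 1 := fun y ↦ by
    rw [rlKernel_one]
    exact Set.indicator_le_self' (by simp) y
  -- For fixed $\xi$ the nonnegative kernels integrate in $z$ to $k_1(x-\xi)\le1$, so $|w|$
  -- dominates and Fubini applies.
  have hint : Integrable (fun p : ℝ × ℝ ↦ rlKernel a (x - p.1) * rlKernel b (p.1 - p.2) * w p.2)
      (volume.prod volume) := by
    have hm : AEStronglyMeasurable
        (fun p : ℝ × ℝ ↦ rlKernel a (x - p.1) * rlKernel b (p.1 - p.2) * w p.2)
        (volume.prod volume) := by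
      have h1 : Measurable fun p : ℝ × ℝ ↦ rlKernel a (x - p.1) * rlKernel b (p.1 - p.2) := by
        fun_prop
      exact h1.aestronglyMeasurable.mul
        (hwi.1.comp_quasiMeasurePreserving Measure.quasiMeasurePreserving_snd)
    rw [integrable_prod_iff' hm]
    refine ⟨ae_of_all _ fun ξ ↦ (integral_rlKernel_mul_rlKernel ha hb x ξ).1.mul_const (w ξ), ?_⟩
    have e2 : ∀ ξ, ∫ z, ‖rlKernel a (x - z) * rlKernel b (z - ξ) * w ξ‖ =
        rlKernel 1 (x - ξ) * ‖w ξ‖ := fun ξ ↦ by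
      rw [← hab, ← (integral_rlKernel_mul_rlKernel ha hb x ξ).2, ← integral_mul_const]
      congr 1
      ext z
      rw [norm_mul, Real.norm_of_nonneg (mul_nonneg (rlKernel_nonneg ha _) (rlKernel_nonneg hb _))]
    simp only [e2]
    refine hwi.norm.mono (((measurable_rlKernel 1).comp
      (by fun_prop)).aestronglyMeasurable.mul hwi.norm.1) (ae_of_all _ fun ξ ↦ ?_)
    rw [norm_mul, Real.norm_of_nonneg (rlKernel_nonneg one_pos _)]
    exact mul_le_of_le_one_left (norm_nonneg _) (hk1 _)
  have e3 := integral_integral_swap (f := fun z ξ ↦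
    rlKernel a (x - z) * rlKernel b (z - ξ) * w ξ) hint
  simp only [integral_mul_const, (integral_rlKernel_mul_rlKernel ha hb x _).2, hab] at e3
  rw [rlConv, rlConv, ← e3]
  congr 1
  ext z
  rw [rlConv, ← integral_const_mul]
  simp only [mul_assoc]

/-- The Riemann-Liouville integral of order at most `1` is injective on `L¹(0, T)`. -/
lemma ae_eq_zero_of_rlConv {T b : ℝ} {u : ℝ → ℝ} (hb : 0 < b) (hb1 : b ≤ 1)
    (h0 : ∀ ξ ≤ 0, u ξ = 0) (hu : IntegrableOn u (Set.Ioo 0 T))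
    (h : ∀ᵐ x ∂volume.restrict (Set.Ioo 0 T), rlConv b u x = 0) :
    ∀ᵐ x ∂volume.restrict (Set.Ioo 0 T), u x = 0 := by
  rw [ae_restrict_iff' measurableSet_Ioo] at h
  have key : ∀ᵐ x, x < T → rlConv b u x = 0 := by
    filter_upwards [h] with x hx hxT
    rcases le_or_gt x 0 with h1 | h1
    · exact rlConv_of_nonpos h0 h1
    · exact hx ⟨h1, hxT⟩
  refine ae_eq_zero_of_intervalIntegral_eq_zero hu ?_
  -- For $b<1$, a further integration of order $1-b$ shows that the primitive of $u$ vanishes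
  -- everywhere. For $b=1$ the primitive vanishes only almost everywhere, and its continuity removes
  -- the exception.
  rcases hb1.lt_or_eq with hb1 | rfl
  · intro x hx
    rw [← rlConv_one h0 hx.1.le, ← rlConv_rlConv (sub_pos.2 hb1) hb (by ring) h0 hu hx.2.le,
      rlConv_congr (v := fun _ ↦ 0)]
    · simp [rlConv]
    · filter_upwards [key] with z hz hzx using hz (hzx.trans hx.2)
  · intro x hx
    have hu' : IntervalIntegrable u volume 0 T :=
      (intervalIntegrable_iff_integrableOn_Ioo_of_le (hx.1.trans hx.2).le).2 hu
    have hcont : ContinuousOn (fun x ↦ ∫ s in 0..x, u s) (Set.Icc 0 T) := by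
      have := intervalIntegral.continuousOn_primitive_interval' hu' Set.left_mem_uIcc
      rwa [Set.uIcc_of_le (hx.1.trans hx.2).le] at this
    have hz : ∀ᵐ x ∂volume.restrict (Set.Ioo 0 T), ∫ s in 0..x, u s = 0 := by
      rw [ae_restrict_iff' measurableSet_Ioo]
      filter_upwards [key] with y hy hyT
      rw [← rlConv_one h0 hyT.1.le, hy hyT.2]
    exact Measure.eqOn_Ioo_of_ae_eq volume hz (hcont.mono Set.Ioo_subset_Icc_self)
      continuousOn_const hx

/-! ### Weak derivatives and inversion of the fractional derivative -/

/-- A primitive of a test function with zero mean is a test function. -/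
lemma exists_test_primitive {T : ℝ} {ψ : ℝ → ℝ} (hψ : ContDiff ℝ (⊤ : ℕ∞) ψ) {K : Set ℝ}
    (hK : IsCompact K) (hKT : K ⊆ Set.Ioo 0 T) (hne : K.Nonempty) (hsupp : ∀ x ∉ K, ψ x = 0)
    (hint : ∫ x, ψ x = 0) :
    ContDiff ℝ (⊤ : ℕ∞) (fun x ↦ ∫ s in 0..x, ψ s) ∧
      HasCompactSupport (fun x ↦ ∫ s in 0..x, ψ s) ∧
      tsupport (fun x ↦ ∫ s in 0..x, ψ s) ⊆ Set.Ioo 0 T := by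
  have hc := hψ.continuous
  have hd : ∀ x, HasDerivAt (fun x ↦ ∫ s in 0..x, ψ s) (ψ x) x := fun x ↦
    intervalIntegral.integral_hasDerivAt_right (hc.intervalIntegrable _ _)
      (hc.stronglyMeasurableAtFilter _ _) hc.continuousAt
  have h1 := hKT (hK.sInf_mem hne)
  have h2 := hKT (hK.sSup_mem hne)
  have hsub : K ⊆ Set.Icc (sInf K) (sSup K) := fun x hx ↦
    ⟨csInf_le hK.bddBelow hx, le_csSup hK.bddAbove hx⟩
  have hz : Function.support (fun x ↦ ∫ s in 0..x, ψ s) ⊆ Set.Icc (sInf K) (sSup K) := by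
    intro x hx
    by_contra hx'
    apply hx
    have hint' : Integrable ψ := hc.integrable_of_hasCompactSupport
      (HasCompactSupport.intro hK hsupp)
    have e1 : ∀ y < sInf K, ∫ s in Set.Iic y, ψ s = 0 := fun y hy ↦
      setIntegral_eq_zero_of_forall_eq_zero fun s hs ↦ hsupp s fun hsK ↦
        absurd (hsub hsK).1 (not_le.2 (lt_of_le_of_lt hs hy))
    -- To the left of $K$ nothing has been integrated yet; to the right of it the whole mean, which
    -- is zero, has been.
    have e2 : ∫ s in Set.Iic x, ψ s = 0 := by
      rcases lt_or_ge x (sInf K) with h | h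
      · exact e1 x h
      · rw [setIntegral_eq_integral_of_forall_compl_eq_zero, hint]
        intro s hs
        refine hsupp s fun hsK ↦ ?_
        have := (hsub hsK).2
        exact hx' ⟨h, le_trans (not_le.1 hs).le this⟩
    change ∫ s in 0..x, ψ s = 0
    rw [← intervalIntegral.integral_Iic_sub_Iic hint'.integrableOn hint'.integrableOn, e2,
      e1 0 h1.1, sub_zero]
  have hts : tsupport (fun x ↦ ∫ s in 0..x, ψ s) ⊆ Set.Icc (sInf K) (sSup K) :=
    closure_minimal hz isClosed_Icc
  refine ⟨contDiff_infty_iff_deriv.2 ⟨fun x ↦ (hd x).differentiableAt, ?_⟩,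
    HasCompactSupport.of_support_subset_isCompact isCompact_Icc hz,
    hts.trans fun x hx ↦ ⟨h1.1.trans_le hx.1, hx.2.trans_lt h2.2⟩⟩
  rwa [show deriv (fun x ↦ ∫ s in 0..x, ψ s) = ψ from funext fun x ↦ (hd x).deriv]

/-- A function with integrable weak derivative is a primitive of it up to a constant. -/
lemma HasWeakDerivOn.exists_const {T : ℝ} {v φ : ℝ → ℝ} (hT : 0 < T)
    (h : HasWeakDerivOn 0 T v φ) (hφ : IntegrableOn φ (Set.Ioo 0 T)) :
    ∃ c, ∀ᵐ x ∂volume.restrict (Set.Ioo 0 T), v x = (∫ s in 0..x, φ s) + c := by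
  have hφ' : IntervalIntegrable φ volume 0 T :=
    (intervalIntegrable_iff_integrableOn_Ioo_of_le hT.le).2 hφ
  set F : ℝ → ℝ := fun x ↦ ∫ s in 0..x, φ s with hF
  have hFac : AbsolutelyContinuousOnInterval F 0 T :=
    hφ'.absolutelyContinuousOnInterval_intervalIntegral Set.left_mem_uIcc
  have hFc : ContinuousOn F (Set.Icc 0 T) := by
    have := hFac.continuousOn
    rwa [Set.uIcc_of_le hT.le] at this
  set D : ℝ → ℝ := fun x ↦ v x - F x with hD
  have hDloc : LocallyIntegrableOn D (Set.Ioo 0 T) :=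
    h.locallyIntegrableOn_fun.sub
      ((hFc.mono Set.Ioo_subset_Icc_self).locallyIntegrableOn measurableSet_Ioo)
  have hDint : ∀ η : ℝ → ℝ, Continuous η → HasCompactSupport η → tsupport η ⊆ Set.Ioo 0 T →
      ∀ G : ℝ → ℝ, LocallyIntegrableOn G (Set.Ioo 0 T) →
      Integrable (fun x ↦ G x * η x) (volume.restrict (Set.Ioo 0 T)) := by
    intro η hη hηc hηs G hG
    have h1 : IntegrableOn (fun x ↦ G x * η x) (tsupport η) :=
      (hG.integrableOn_compact_subset hηs hηc).mul_continuousOn hη.continuousOn hηc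
    refine ((integrableOn_iff_integrable_of_support_subset ?_).1 h1).integrableOn
    exact fun x hx ↦ subset_tsupport η (right_ne_zero_of_mul hx)
  -- $D=v-F$ has zero weak derivative: the primitive of a zero-mean $\psi$ is an admissible test
  -- function, and $F$ is integrated by parts against it.
  have hDtest : ∀ ψ : ℝ → ℝ, ContDiff ℝ (⊤ : ℕ∞) ψ → ∀ K : Set ℝ, IsCompact K →
      K ⊆ Set.Ioo 0 T → K.Nonempty → (∀ x ∉ K, ψ x = 0) → ∫ x, ψ x = 0 →
      ∫ x in Set.Ioo 0 T, D x * ψ x = 0 := by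
    intro ψ hψ K hK hKT hne hsupp hint
    obtain ⟨t1, t2, t3⟩ := exists_test_primitive hψ hK hKT hne hsupp hint
    set θ : ℝ → ℝ := fun x ↦ ∫ s in 0..x, ψ s with hθ
    have hc := hψ.continuous
    have hψs : tsupport ψ ⊆ Set.Ioo 0 T :=
      (closure_minimal (fun x hx ↦ by_contra fun h' ↦ hx (hsupp x h'))
        hK.isClosed : tsupport ψ ⊆ K).trans hKT
    have hψc : HasCompactSupport ψ := HasCompactSupport.intro hK hsupp
    have hd : deriv θ = ψ := funext fun x ↦
      (intervalIntegral.integral_hasDerivAt_right (hc.intervalIntegrable _ _)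
        (hc.stronglyMeasurableAtFilter _ _) hc.continuousAt).deriv
    have hθac : AbsolutelyContinuousOnInterval θ 0 T :=
      (hc.intervalIntegrable 0 T).absolutelyContinuousOnInterval_intervalIntegral
        Set.left_mem_uIcc
    have hv := h.integral_eq θ t1 t2 t3
    have hp := hFac.integral_mul_deriv_eq_deriv_mul hθac
    have hθT : θ T = 0 := by
      by_contra h'
      exact lt_irrefl T (t3 (subset_tsupport θ h')).2
    have hθ0 : θ 0 = 0 := by simp [hθ]
    have hdF : ∫ x in 0..T, deriv F x * θ x = ∫ x in 0..T, φ x * θ x := by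
      refine intervalIntegral.integral_congr_ae ?_
      filter_upwards [hφ'.ae_hasDerivAt_integral] with x hx hxT
      rw [(hx (Set.uIoc_subset_uIcc hxT) 0 Set.left_mem_uIcc).deriv]
    rw [hd, hθT, hθ0, hdF, intervalIntegral.integral_of_le hT.le,
      intervalIntegral.integral_of_le hT.le, integral_Ioc_eq_integral_Ioo,
      integral_Ioc_eq_integral_Ioo] at hp
    rw [hd] at hv
    simp only [hD, sub_mul]
    rw [integral_sub, hv, hp]
    · ring
    · exact hDint ψ hc hψc hψs v h.locallyIntegrableOn_fun
    · exact hDint ψ hc hψc hψs F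
        ((hFc.mono Set.Ioo_subset_Icc_self).locallyIntegrableOn measurableSet_Ioo)
  -- A bump $\zeta$ of integral one inside $(0,T)$. Subtracting $m\zeta$, with $m=\int\eta$, makes
  -- any test function $\eta$ zero-mean, which identifies the constant as $\int D\zeta$.
  let b : ContDiffBump (T / 2) := ⟨T / 8, T / 4, by linarith, by linarith⟩
  set ζ : ℝ → ℝ := b.normed volume with hζ
  have hζs : tsupport ζ ⊆ Set.Ioo 0 T := by
    rw [hζ, b.tsupport_normed_eq, Real.closedBall_eq_Icc]
    intro x hx
    constructor <;> linarith [hx.1, hx.2, show b.rOut = T / 4 from rfl]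
  have hζc : HasCompactSupport ζ := b.hasCompactSupport_normed
  have hζd : ContDiff ℝ (⊤ : ℕ∞) ζ := b.contDiff_normed
  have hζne : (tsupport ζ).Nonempty := by
    rw [hζ, b.tsupport_normed_eq]
    exact Metric.nonempty_closedBall.2 b.rOut_pos.le
  set c := ∫ x in Set.Ioo 0 T, D x * ζ x with hc
  refine ⟨c, ?_⟩
  have hconst : LocallyIntegrableOn (fun _ : ℝ ↦ c) (Set.Ioo 0 T) :=
    (locallyIntegrable_const c).locallyIntegrableOn _
  have key := isOpen_Ioo.ae_eq_zero_of_integral_contDiff_smul_eq_zero (U := Set.Ioo 0 T)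
    (hDloc.sub hconst) (μ := volume) ?_
  · rw [ae_restrict_iff' measurableSet_Ioo]
    filter_upwards [key] with x hx hxT
    have := hx hxT
    simp only [hD, Pi.sub_apply] at this
    linarith
  intro η hη hηc hηs
  have hηi : Integrable η := hη.continuous.integrable_of_hasCompactSupport hηc
  have hζi : Integrable ζ := b.integrable_normed
  set m := ∫ x, η x with hm
  have h1 := hDtest (fun x ↦ η x - m * ζ x) (hη.sub (contDiff_const.mul hζd))
    (tsupport η ∪ tsupport ζ) (hηc.isCompact.union hζc.isCompact) (Set.union_subset hηs hζs)
    (hζne.mono Set.subset_union_right)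
    (fun x hx ↦ by
      rw [Set.mem_union, not_or] at hx
      rw [image_eq_zero_of_notMem_tsupport hx.1, image_eq_zero_of_notMem_tsupport hx.2]
      ring)
    (by
      rw [integral_sub hηi (hζi.const_mul _), integral_const_mul, b.integral_normed]
      simp [hm])
  have h2 : ∀ x, D x * (η x - m * ζ x) = D x * η x - m * (D x * ζ x) := fun x ↦ by ring
  simp only [h2] at h1
  rw [integral_sub (hDint η hη.continuous hηc hηs D hDloc)
    ((hDint ζ hζd.continuous hζc hζs D hDloc).const_mul m), integral_const_mul, ← hc] at h1
  have hηm : ∫ x in Set.Ioo 0 T, η x = m :=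
    setIntegral_eq_integral_of_forall_compl_eq_zero fun x hx ↦
      image_eq_zero_of_notMem_tsupport fun h ↦ hx (hηs h)
  rw [← setIntegral_eq_integral_of_forall_compl_eq_zero (s := Set.Ioo 0 T)]
  · have h3 : ∀ x, η x • (D - (fun _ ↦ c) : ℝ → ℝ) x = D x * η x - c * η x := fun x ↦ by
      simp only [smul_eq_mul, Pi.sub_apply]
      ring
    simp only [h3]
    rw [integral_sub (hDint η hη.continuous hηc hηs D hDloc) (hηi.integrableOn.const_mul c),
      integral_const_mul, hηm]
    linarith
  · intro x hx
    rw [image_eq_zero_of_notMem_tsupport fun h ↦ hx (hηs h), zero_smul]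

lemma rlConv_indicator_eq_rlIntegral {T a x : ℝ} {g : ℝ → ℝ} (hx : x ∈ Set.Ioo 0 T) :
    rlConv a ((Set.Ioo 0 T).indicator g) x = rlIntegral 0 a g x := by
  rw [rlConv_eq_rlIntegral (fun ξ hξ ↦
    Set.indicator_of_notMem (fun h ↦ absurd h.1 hξ.not_gt) _) hx.1.le, rlIntegral, rlIntegral]
  congr 1
  refine intervalIntegral.integral_congr_ae (ae_of_all _ fun ξ hξ ↦ ?_)
  rw [Set.uIoc_of_le hx.1.le] at hξ
  rw [Set.indicator_of_mem]
  exact ⟨hξ.1, hξ.2.trans_lt hx.2⟩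

/-- If `φ ∈ L²(0, T)` is the Riemann-Liouville derivative of order `β ∈ (0, 1/2)` of
`g ∈ L²(0, T)`, then `g` is the Riemann-Liouville integral of `φ`. -/
lemma HasRLDeriv.ae_eq_rlConv {T β : ℝ} {g φ : ℝ → ℝ} (hT : 0 < T) (hβ : 0 < β)
    (hβ' : β < 1 / 2) (h : HasRLDeriv T β g φ)
    (hg : MemLp g 2 (volume.restrict (Set.Ioo 0 T)))
    (hφ : MemLp φ 2 (volume.restrict (Set.Ioo 0 T))) :
    ∀ᵐ x ∂volume.restrict (Set.Ioo 0 T),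
      g x = rlConv β ((Set.Ioo 0 T).indicator φ) x := by
  have hm := measurableSet_Ioo (a := (0 : ℝ)) (b := T)
  have hind : ∀ u : ℝ → ℝ, ∀ ξ ≤ 0, (Set.Ioo 0 T).indicator u ξ = 0 := fun u ξ hξ ↦
    Set.indicator_of_notMem (fun h ↦ absurd h.1 hξ.not_gt) _
  have hindL : ∀ u : ℝ → ℝ, MemLp u 2 (volume.restrict (Set.Ioo 0 T)) →
      MemLp ((Set.Ioo 0 T).indicator u) 2 (volume.restrict (Set.Ioo 0 T)) := fun u hu ↦
    hu.ae_eq (indicator_ae_eq_restrict hm).symm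
  have hL1 : ∀ {u : ℝ → ℝ}, MemLp u 2 (volume.restrict (Set.Ioo 0 T)) →
      IntegrableOn u (Set.Ioo 0 T) := fun hu ↦ hu.integrable (by norm_num)
  set g' := (Set.Ioo 0 T).indicator g with hg'
  set φ' := (Set.Ioo 0 T).indicator φ with hφ'
  have hw := h.1 hβ
  obtain ⟨c, hc⟩ := hw.exists_const hT (hL1 hφ)
  have hRφ0 : ∀ ξ ≤ 0, rlConv β φ' ξ = 0 := fun ξ hξ ↦ rlConv_of_nonpos (hind φ) hξ
  have hRφ := memLp_rlConv hβ (hind φ) (hindL φ hφ)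
  -- The weak derivative gives
  -- $I^{1-\beta}g=\int_0^{\cdot}\varphi+c=I^{1-\beta}(I^\beta\varphi+c\,k_\beta)$, so $I^{1-\beta}$
  -- annihilates this difference.
  set k : ℝ → ℝ := fun x ↦ g' x - rlConv β φ' x - c * rlKernel β x with hk
  have hkL : IntegrableOn k (Set.Ioo 0 T) :=
    ((hL1 (hindL g hg)).sub (hL1 hRφ)).sub
      (((integrableOn_rlKernel hβ 0 T).mono_set Set.Ioo_subset_Ioc_self).const_mul c)
  have hk0 : ∀ ξ ≤ 0, k ξ = 0 := fun ξ hξ ↦ by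
    simp only [hk, hind g ξ hξ, hRφ0 ξ hξ, rlKernel_of_nonpos hξ, hg']
    ring
  have hRk : ∀ᵐ x ∂volume.restrict (Set.Ioo 0 T), rlConv (1 - β) k x = 0 := by
    filter_upwards [hc, ae_integrable_rlConv (a := 1 - β) (by linarith) (hind g) (hindL g hg),
      ae_integrable_rlConv (a := 1 - β) (by linarith) hRφ0 hRφ, ae_restrict_mem hm]
      with x hx h1 h2 hxT
    have hker := integral_rlKernel_mul_rlKernel (a := 1 - β) (by linarith) hβ x 0
    simp only [sub_zero, sub_add_cancel, rlKernel_one] at hker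
    have e1 : rlConv (1 - β) k x =
        rlConv (1 - β) g' x - rlConv (1 - β) (rlConv β φ') x - c := by
      have : ∀ ξ, rlKernel (1 - β) (x - ξ) * k ξ = rlKernel (1 - β) (x - ξ) * g' ξ -
          rlKernel (1 - β) (x - ξ) * rlConv β φ' ξ -
          c * (rlKernel (1 - β) (x - ξ) * rlKernel β ξ) := fun ξ ↦ by
        simp only [hk]; ring
      rw [rlConv]
      simp only [this]
      have h12 : Integrable fun ξ ↦ rlKernel (1 - β) (x - ξ) * g' ξ -
          rlKernel (1 - β) (x - ξ) * rlConv β φ' ξ := h1.sub h2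
      rw [integral_sub h12 (hker.1.const_mul c), integral_sub h1 h2, integral_const_mul,
        hker.2, Set.indicator_of_mem (Set.mem_Ioi.2 hxT.1), Pi.one_apply, mul_one]
      rfl
    have e2 : rlConv (1 - β) g' x = rlIntegral 0 (1 - β) g x :=
      rlConv_indicator_eq_rlIntegral hxT
    have e3 : rlConv 1 φ' x = ∫ s in 0..x, φ s := by
      rw [rlConv_indicator_eq_rlIntegral hxT]
      simp [rlIntegral]
    rw [e1, e2, hx, rlConv_rlConv (by linarith) hβ (by ring) (hind φ) (hL1 (hindL φ hφ)) hxT.2.le,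
      e3]
    ring
  have hkz := ae_eq_zero_of_rlConv (by linarith) (by linarith) hk0 hkL hRk
  -- The term $c\,k_\beta$ would be in $L^2(0,T)$, as a difference of $L^2$ functions. Since
  -- $\beta<1/2$, $x^{2(\beta-1)}$ is not integrable at $0$.
  have hkβ : c = 0 := by
    by_contra hc0
    have h1 : MemLp (fun x ↦ c * rlKernel β x) 2 (volume.restrict (Set.Ioo 0 T)) := by
      refine ((hindL g hg).sub hRφ).ae_eq ?_
      filter_upwards [hkz] with x hx
      simp only [hk] at hx
      simp only [Pi.sub_apply]
      linarith
    have h2 : MemLp (fun x : ℝ ↦ x ^ (β - 1)) 2 (volume.restrict (Set.Ioo 0 T)) := by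
      refine (h1.const_mul (Real.Gamma β / c)).ae_eq
        (ae_restrict_of_forall_mem hm fun x hx ↦ ?_)
      have := (Real.Gamma_pos_of_pos hβ).ne'
      simp only [rlKernel_of_pos hx.1]
      field_simp
    have h3 : IntegrableOn (fun x : ℝ ↦ x ^ ((β - 1) * 2)) (Set.Ioo 0 T) := by
      refine h2.integrable_sq.congr (ae_restrict_of_forall_mem hm fun x hx ↦ ?_)
      simp only
      rw [Real.rpow_mul hx.1.le, Real.rpow_two]
    rw [intervalIntegral.integrableOn_Ioo_rpow_iff hT] at h3
    linarith
  filter_upwards [hkz, ae_restrict_mem hm] with x hx hxT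
  simp only [hk, hkβ, zero_mul, sub_zero, hg', Set.indicator_of_mem hxT] at hx
  linarith

/-! ### Step functions and their energy -/

namespace StepFunction

variable {T : ℝ}

/-- The sum of the increments of `F` over the steps of `f`, weighted by the values of `f`. -/
def comb (f : StepFunction T) (F : ℝ≥0 → ℝ) : ℝ := ∑ i, f.c i * (F (f.r i) - F (f.l i))

/-- The sum of two step functions. -/
def add (f h : StepFunction T) : StepFunction T where
  n := f.n + h.n
  c := Fin.append f.c h.c
  l := Fin.append f.l h.l
  r := Fin.append f.r h.r
  l_le_r i := by
    induction i using Fin.addCases with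
    | left i => simpa using f.l_le_r i
    | right i => simpa using h.l_le_r i
  r_le i := by
    induction i using Fin.addCases with
    | left i => simpa using f.r_le i
    | right i => simpa using h.r_le i

/-- A multiple of a step function. -/
def smul (a : ℝ) (f : StepFunction T) : StepFunction T where
  n := f.n
  c := fun i ↦ a * f.c i
  l := f.l
  r := f.r
  l_le_r := f.l_le_r
  r_le := f.r_le

/-- The difference of two step functions. -/
def sub (f h : StepFunction T) : StepFunction T := f.add (h.smul (-1))

/-- The zero step function. -/
def zero (T : ℝ) : StepFunction T where
  n := 0
  c := Fin.elim0
  l := Fin.elim0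
  r := Fin.elim0
  l_le_r i := i.elim0
  r_le i := i.elim0

/-- The function `1_{(l, r]}` as a step function. -/
def single (l r : ℝ≥0) (hlr : l ≤ r) (hr : (r : ℝ) ≤ T) : StepFunction T where
  n := 1
  c _ := 1
  l _ := l
  r _ := r
  l_le_r _ := hlr
  r_le _ := hr

/-- The step function `x ↦ f (T - x)`, up to the values at the end points of the steps. -/
def reflect (f : StepFunction T) : StepFunction T where
  n := f.n
  c := f.c
  l i := T.toNNReal - f.r i
  r i := T.toNNReal - f.l i
  l_le_r i := tsub_le_tsub_left (f.l_le_r i) _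
  r_le i := by
    have h1 : (f.l i : ℝ) ≤ T := le_trans (by exact_mod_cast f.l_le_r i) (f.r_le i)
    have h0 : 0 ≤ T := (f.l i).2.trans h1
    calc ((T.toNNReal - f.l i : ℝ≥0) : ℝ) ≤ (T.toNNReal : ℝ) := by exact_mod_cast tsub_le_self
      _ = T := Real.coe_toNNReal T h0

lemma comb_add (f h : StepFunction T) (F : ℝ≥0 → ℝ) :
    (f.add h).comb F = f.comb F + h.comb F := by
  change ∑ i : Fin (f.n + h.n), Fin.append f.c h.c i *
    (F (Fin.append f.r h.r i) - F (Fin.append f.l h.l i)) = _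
  simp [comb, Fin.sum_univ_add]

lemma comb_smul (a : ℝ) (f : StepFunction T) (F : ℝ≥0 → ℝ) :
    (f.smul a).comb F = a * f.comb F := by
  change ∑ i : Fin f.n, a * f.c i * (F (f.r i) - F (f.l i)) = _
  simp [comb, Finset.mul_sum, mul_assoc]

lemma comb_sub (f h : StepFunction T) (F : ℝ≥0 → ℝ) :
    (f.sub h).comb F = f.comb F - h.comb F := by
  rw [sub, comb_add, comb_smul]
  ring

lemma comb_zero (F : ℝ≥0 → ℝ) : (zero T).comb F = 0 := by
  simp [comb, zero]

lemma comb_single {l r : ℝ≥0} (hlr : l ≤ r) (hr : (r : ℝ) ≤ T) (F : ℝ≥0 → ℝ) :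
    (single l r hlr hr).comb F = F r - F l := by
  change ∑ i : Fin 1, (1 : ℝ) * (F r - F l) = _
  simp

lemma l_le (f : StepFunction T) (i : Fin f.n) : (f.l i : ℝ) ≤ T :=
  le_trans (by exact_mod_cast f.l_le_r i) (f.r_le i)

lemma coe_reflect_l (f : StepFunction T) (i : Fin f.n) : (f.reflect.l i : ℝ) = T - f.r i := by
  have h1 := f.r_le i
  have h0 : 0 ≤ T := (f.r i).2.trans h1
  simp only [reflect]
  rw [NNReal.coe_sub (by rwa [← NNReal.coe_le_coe, Real.coe_toNNReal T h0]),
    Real.coe_toNNReal T h0]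

lemma coe_reflect_r (f : StepFunction T) (i : Fin f.n) : (f.reflect.r i : ℝ) = T - f.l i := by
  have h1 := f.l_le i
  have h0 : 0 ≤ T := (f.l i).2.trans h1
  simp only [reflect]
  rw [NNReal.coe_sub (by rwa [← NNReal.coe_le_coe, Real.coe_toNNReal T h0]),
    Real.coe_toNNReal T h0]

/-- Since $k_1$ is the indicator of the open half-line, $k_1(x-l)-k_1(x-r)$ is exactly $\mathbf
1_{(l,r]}(x)$, end points included. A step function is thus its own `forward` of order $1$. -/
lemma toFun_eq_comb (f : StepFunction T) (x : ℝ) :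
    f.toFun x = f.comb fun y ↦ -rlKernel 1 (x - y) := by
  refine Finset.sum_congr rfl fun i _ ↦ ?_
  have h : (f.l i : ℝ) ≤ f.r i := by exact_mod_cast f.l_le_r i
  simp only [rlKernel_one, Set.indicator, Set.mem_Ioi, Set.mem_Ioc, sub_pos, Pi.one_apply]
  split_ifs <;> try simp
  all_goals exfalso; grind

/-- Reflection of the argument, up to the finitely many end points of the steps. -/
lemma toFun_reflect (f : StepFunction T) :
    ∀ᵐ x, f.reflect.toFun x = f.toFun (T - x) := by
  have h : ∀ᵐ x : ℝ, ∀ i, x ≠ T - f.r i ∧ x ≠ T - f.l i := by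
    rw [ae_all_iff]
    intro i
    filter_upwards [measure_eq_zero_iff_ae_notMem.1 (measure_singleton (T - f.r i : ℝ)),
      measure_eq_zero_iff_ae_notMem.1 (measure_singleton (T - f.l i : ℝ))] with x h1 h2
    exact ⟨h1, h2⟩
  filter_upwards [h] with x hx
  change ∑ i : Fin f.n, (Set.Ioc (f.reflect.l i : ℝ) (f.reflect.r i)).indicator
    (fun _ ↦ f.c i) x = _
  refine Finset.sum_congr rfl fun i _ ↦ ?_
  rw [coe_reflect_l, coe_reflect_r]
  obtain ⟨h1, h2⟩ := hx i
  simp only [Set.indicator, Set.mem_Ioc]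
  have e : (T - f.r i < x ∧ x ≤ T - f.l i) ↔ (f.l i < T - x ∧ T - x ≤ f.r i) := by
    constructor
    · rintro ⟨h3, h4⟩
      have := h4.lt_of_ne h2
      constructor <;> linarith
    · rintro ⟨h3, h4⟩
      have : T - f.r i ≤ x := by linarith
      exact ⟨this.lt_of_ne' h1, by linarith⟩
  simp only [e]

/-- The quadratic form of a step function associated with a variogram `d`. -/
noncomputable def energy (f : StepFunction T) (d : ℝ≥0 → ℝ≥0 → ℝ) : ℝ :=
  -(1 / 2) * ∑ i, ∑ j, f.c i * f.c j *
    (d (f.r i) (f.r j) - d (f.r i) (f.l j) - d (f.l i) (f.r j) + d (f.l i) (f.l j))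

lemma energy_const_mul (f : StepFunction T) (κ : ℝ) (d : ℝ≥0 → ℝ≥0 → ℝ) :
    f.energy (fun x y ↦ κ * d x y) = κ * f.energy d := by
  simp only [energy, Finset.mul_sum]
  refine Finset.sum_congr rfl fun i _ ↦ Finset.sum_congr rfl fun j _ ↦ ?_
  ring

/-- Polarization: a product of combinations of increments in terms of the products of single
increments. -/
lemma comb_mul_comb (f : StepFunction T) (u v : ℝ≥0 → ℝ) :
    f.comb u * f.comb v = f.energy fun x y ↦ (u x - u y) * (v x - v y) := by
  have h1 : f.comb u * f.comb v = ∑ i, ∑ j, f.c i * f.c j *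
      ((u (f.r i) - u (f.l i)) * (v (f.r j) - v (f.l j))) := by
    rw [comb, comb, Finset.sum_mul_sum]
    refine Finset.sum_congr rfl fun i _ ↦ Finset.sum_congr rfl fun j _ ↦ ?_
    ring
  -- The energy form contains the cross terms in both orders, so the double sum is averaged with its
  -- transpose. The diagonal products $u_xv_x$ cancel in the second difference.
  have h2 : f.comb u * f.comb v = ∑ i, ∑ j, f.c i * f.c j *
      ((u (f.r j) - u (f.l j)) * (v (f.r i) - v (f.l i))) := by
    rw [h1, Finset.sum_comm]
    refine Finset.sum_congr rfl fun i _ ↦ Finset.sum_congr rfl fun j _ ↦ ?_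
    ring
  have h3 : f.comb u * f.comb v = (1 / 2) * (f.comb u * f.comb v + f.comb u * f.comb v) := by ring
  rw [h3]
  nth_rewrite 1 [h1]
  rw [h2, ← Finset.sum_add_distrib, energy, Finset.mul_sum, Finset.mul_sum]
  refine Finset.sum_congr rfl fun i _ ↦ ?_
  rw [← Finset.sum_add_distrib, Finset.mul_sum, Finset.mul_sum]
  refine Finset.sum_congr rfl fun j _ ↦ ?_
  ring

/-- Reduces an identity between quadratic forms to single increments. It serves three times: for the
process on $\Omega$, for the square of the backward kernel, and for the forward-backward product. -/
lemma integral_comb_mul_comb {Ω : Type*} [MeasurableSpace Ω] {μ : Measure Ω}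
    (f : StepFunction T) {u v : ℝ≥0 → Ω → ℝ} {κ : ℝ} {d : ℝ≥0 → ℝ≥0 → ℝ}
    (h : ∀ x y, Integrable (fun ω ↦ (u x ω - u y ω) * (v x ω - v y ω)) μ ∧
      ∫ ω, (u x ω - u y ω) * (v x ω - v y ω) ∂μ = κ * d x y) :
    Integrable (fun ω ↦ f.comb (u · ω) * f.comb (v · ω)) μ ∧
      ∫ ω, f.comb (u · ω) * f.comb (v · ω) ∂μ = κ * f.energy d := by
  simp only [comb_mul_comb, ← energy_const_mul]
  have hi : ∀ i j, Integrable (fun ω ↦ f.c i * f.c j *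
      ((u (f.r i) ω - u (f.r j) ω) * (v (f.r i) ω - v (f.r j) ω) -
      (u (f.r i) ω - u (f.l j) ω) * (v (f.r i) ω - v (f.l j) ω) -
      (u (f.l i) ω - u (f.r j) ω) * (v (f.l i) ω - v (f.r j) ω) +
      (u (f.l i) ω - u (f.l j) ω) * (v (f.l i) ω - v (f.l j) ω))) μ := fun i j ↦
    ((((h _ _).1.sub (h _ _).1).sub (h _ _).1).add (h _ _).1).const_mul _
  refine ⟨(integrable_finsetSum _ fun i _ ↦ integrable_finsetSum _ fun j _ ↦
    hi i j).const_mul _, ?_⟩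
  simp only [energy]
  rw [integral_const_mul, integral_finsetSum _ fun i _ ↦ integrable_finsetSum _ fun j _ ↦ hi i j]
  congr 1
  refine Finset.sum_congr rfl fun i _ ↦ ?_
  rw [integral_finsetSum _ fun j _ ↦ hi i j]
  refine Finset.sum_congr rfl fun j _ ↦ ?_
  have i1 := (h (f.r i) (f.r j))
  have i2 := (h (f.r i) (f.l j))
  have i3 := (h (f.l i) (f.r j))
  have i4 := (h (f.l i) (f.l j))
  rw [integral_const_mul, ← i1.2, ← i2.2, ← i3.2, ← i4.2]
  have i12 := i1.1.sub i2.1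
  have i123 := i12.sub i3.1
  simp only [Pi.sub_def] at i12 i123
  rw [integral_add i123 i4.1, integral_sub i12 i3.1, integral_sub i1.1 i2.1]

/-- The variogram of fractional Brownian motion. -/
noncomputable def _root_.FBM.variogram (H : ℝ) (x y : ℝ≥0) : ℝ := |(x : ℝ) - y| ^ (2 * H)

lemma energy_reflect (f : StepFunction T) (H : ℝ) :
    f.reflect.energy (variogram H) = f.energy (variogram H) := by
  rw [energy, energy]
  congr 1
  change ∑ i : Fin f.n, ∑ j : Fin f.n, f.c i * f.c j *
    (variogram H (f.reflect.r i) (f.reflect.r j) - variogram H (f.reflect.r i) (f.reflect.l j) -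
      variogram H (f.reflect.l i) (f.reflect.r j) +
      variogram H (f.reflect.l i) (f.reflect.l j)) = _
  refine Finset.sum_congr rfl fun i _ ↦ Finset.sum_congr rfl fun j _ ↦ ?_
  simp only [variogram, coe_reflect_l, coe_reflect_r, sub_sub_sub_cancel_left]
  rw [abs_sub_comm (f.l j : ℝ) (f.l i), abs_sub_comm (f.r j : ℝ) (f.l i),
    abs_sub_comm (f.l j : ℝ) (f.r i), abs_sub_comm (f.r j : ℝ) (f.r i)]
  ring

end StepFunction

/-! ### Variograms of the process and of the fractional kernels -/

lemma IsFBM.memLp {Ω : Type*} [MeasurableSpace Ω] {P : Measure Ω} {H : ℝ} {W : ℝ≥0 → Ω → ℝ}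
    (hW : IsFBM H W P) (t : ℝ≥0) : MemLp (W t) 2 P :=
  (hW.isGaussianProcess.hasGaussianLaw_eval t).memLp_two

lemma IsFBM.integral_increment_sq {Ω : Type*} [MeasurableSpace Ω] {P : Measure Ω} {H : ℝ}
    {W : ℝ≥0 → Ω → ℝ} (hH : 0 < H) (h : IsFBM H W P) (x y : ℝ≥0) :
    Integrable (fun ω ↦ (W x ω - W y ω) * (W x ω - W y ω)) P ∧
      ∫ ω, (W x ω - W y ω) * (W x ω - W y ω) ∂P = variogram H x y := by
  have hi : ∀ s t, Integrable (fun ω ↦ W s ω * W t ω) P := fun s t ↦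
    (h.memLp s).integrable_mul (h.memLp t)
  have e : ∀ ω, (W x ω - W y ω) * (W x ω - W y ω) =
      W x ω * W x ω - 2 * (W x ω * W y ω) + W y ω * W y ω := fun ω ↦ by ring
  simp only [e]
  have h1 : Integrable (fun ω ↦ W x ω * W x ω - 2 * (W x ω * W y ω)) P :=
    (hi x x).sub ((hi x y).const_mul 2)
  refine ⟨h1.add (hi y y), ?_⟩
  rw [integral_add h1 (hi y y), integral_sub (hi x x) ((hi x y).const_mul 2), integral_const_mul,
    h.covariance, h.covariance, h.covariance, variogram, sub_self, sub_self, abs_zero,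
    Real.zero_rpow (by positivity), abs_sub_comm]
  ring

/-- The squared increment of the Mandelbrot-Van Ness kernel is integrable. -/
lemma integrable_rlKernel_increment_sq {a : ℝ} (ha : 1 / 2 < a) (ha' : a < 3 / 2) :
    Integrable fun t ↦ (rlKernel a (t + 1) - rlKernel a t) ^ 2 := by
  have hm : Measurable fun t ↦ rlKernel a (t + 1) - rlKernel a t := by fun_prop
  have hshift : MemLp (fun t ↦ rlKernel a (t + 1)) 2 (volume.restrict (Set.Ioc (-1) 1)) := by
    have h := ((measurePreserving_add_right (volume : Measure ℝ) 1).restrict_preimage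
      (measurableSet_Ioc (a := (0 : ℝ)) (b := 2)))
    have e : (fun x : ℝ ↦ x + 1) ⁻¹' Set.Ioc 0 2 = Set.Ioc (-1) 1 := by
      ext x
      simp only [Set.mem_preimage, Set.mem_Ioc]
      constructor <;> rintro ⟨h1, h2⟩ <;> constructor <;> linarith
    rw [e] at h
    exact (memLp_rlKernel ha 0 2).comp_measurePreserving h
  have h1 : IntegrableOn (fun t ↦ (rlKernel a (t + 1) - rlKernel a t) ^ 2) (Set.Ioc (-1) 1) :=
    (hshift.sub (memLp_rlKernel ha (-1) 1)).integrable_sq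
  have h2 : IntegrableOn (fun t ↦ (rlKernel a (t + 1) - rlKernel a t) ^ 2) (Set.Iic (-1)) := by
    refine integrableOn_zero.congr_fun (fun t ht ↦ ?_) measurableSet_Iic
    have ht' : t ≤ -1 := ht
    rw [rlKernel_of_nonpos (by linarith), rlKernel_of_nonpos (by linarith)]
    simp
  have h3 : IntegrableOn (fun t ↦ (rlKernel a (t + 1) - rlKernel a t) ^ 2) (Set.Ioi 1) := by
    have hΓ := Real.Gamma_pos_of_pos (show 0 < a by linarith)
    have hdom : IntegrableOn
        (fun t : ℝ ↦ ((a - 1) / Real.Gamma a) ^ 2 * t ^ ((a - 2) * 2)) (Set.Ioi 1) :=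
      (integrableOn_Ioi_rpow_of_lt (by linarith) one_pos).const_mul _
    refine hdom.mono' (hm.pow_const 2).aestronglyMeasurable
      (ae_restrict_of_forall_mem measurableSet_Ioi fun t ht ↦ ?_)
    have ht1 : 1 < t := ht
    have ht0 : 0 < t := by linarith
    -- By the mean value theorem the increment decays like $t^{a-2}$, which is square integrable at
    -- infinity precisely because $a<3/2$.
    obtain ⟨c, hc, hc'⟩ := exists_hasDerivAt_eq_slope (fun s : ℝ ↦ s ^ (a - 1))
      (fun s ↦ (a - 1) * s ^ (a - 1 - 1)) (show t < t + 1 by linarith)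
      (fun s hs ↦ (Real.continuousAt_rpow_const s _
        (Or.inl (by linarith [hs.1]))).continuousWithinAt)
      (fun s hs ↦ Real.hasDerivAt_rpow_const (Or.inl (by linarith [hs.1])))
    rw [add_sub_cancel_left, div_one] at hc'
    rw [rlKernel_of_pos (by linarith), rlKernel_of_pos ht0, ← sub_div, ← hc', Real.rpow_mul ht0.le,
      Real.rpow_two, ← mul_pow, Real.norm_of_nonneg (sq_nonneg _), div_mul_eq_mul_div]
    rw [show a - 1 - 1 = a - 2 by ring, div_pow, div_pow, mul_pow, mul_pow]
    have hle : c ^ (a - 2) ≤ t ^ (a - 2) :=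
      Real.rpow_le_rpow_of_nonpos ht0 hc.1.le (by linarith)
    have := Real.rpow_nonneg (ht0.trans hc.1).le (a - 2)
    gcongr
  have h4 := (h2.union h1).union h3
  rw [Set.Iic_union_Ioc_eq_Iic (by norm_num), Set.Iic_union_Ioi] at h4
  exact integrableOn_univ.1 h4

lemma integral_rlKernel_increment_sq_pos {a : ℝ} (ha : 1 / 2 < a) (ha' : a < 3 / 2) :
    0 < ∫ t, (rlKernel a (t + 1) - rlKernel a t) ^ 2 := by
  rw [integral_pos_iff_support_of_nonneg (fun t ↦ sq_nonneg _)
    (integrable_rlKernel_increment_sq ha ha')]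
  refine lt_of_lt_of_le ?_ (measure_mono (s := Set.Ioo (-1 : ℝ) 0) fun t ht ↦ ?_)
  · simp
  · have hΓ := Real.Gamma_pos_of_pos (show 0 < a by linarith)
    have h1 : 0 < t + 1 := by linarith [ht.1]
    rw [Function.mem_support, rlKernel_of_pos h1, rlKernel_of_nonpos ht.2.le]
    rw [sub_zero]
    exact (pow_pos (div_pos (Real.rpow_pos_of_pos h1 (a - 1)) hΓ) 2).ne'

/-- The increments of the Mandelbrot-Van Ness kernel have the variogram of fractional Brownian
motion, up to a constant. -/
lemma integral_backward_kernel {H : ℝ} (hH0 : 0 < H) (hH1 : H < 1) (x y : ℝ≥0) :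
    Integrable (fun t ↦ (rlKernel (H + 1 / 2) (x - t) - rlKernel (H + 1 / 2) (y - t)) *
        (rlKernel (H + 1 / 2) (x - t) - rlKernel (H + 1 / 2) (y - t))) ∧
      ∫ t, (rlKernel (H + 1 / 2) (x - t) - rlKernel (H + 1 / 2) (y - t)) *
        (rlKernel (H + 1 / 2) (x - t) - rlKernel (H + 1 / 2) (y - t)) =
      (∫ t, (rlKernel (H + 1 / 2) (t + 1) - rlKernel (H + 1 / 2) t) ^ 2) * variogram H x y := by
  set a := H + 1 / 2 with ha
  have hq := integrable_rlKernel_increment_sq (a := a) (by linarith) (by linarith)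
  set q : ℝ → ℝ := fun t ↦ (rlKernel a (t + 1) - rlKernel a t) ^ 2 with hqd
  have main : ∀ x y : ℝ, y < x →
      Integrable (fun t ↦ (rlKernel a (x - t) - rlKernel a (y - t)) *
        (rlKernel a (x - t) - rlKernel a (y - t))) ∧
      ∫ t, (rlKernel a (x - t) - rlKernel a (y - t)) *
        (rlKernel a (x - t) - rlKernel a (y - t)) = (∫ t, q t) * |x - y| ^ (2 * H) := by
    intro x y hxy
    set c := x - y with hc
    have hc0 : 0 < c := by linarith
    -- Homogeneity of the kernel reduces to an increment of length one; the total power of $c$ is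
    -- $2(a-1)+1=2H$.
    have e : (fun t ↦ (rlKernel a (x - t) - rlKernel a (y - t)) *
        (rlKernel a (x - t) - rlKernel a (y - t))) =
        fun t ↦ (c ^ (a - 1)) ^ 2 * q (c⁻¹ * (y - t)) := by
      ext t
      have e1 : x - t = c * (c⁻¹ * (y - t) + 1) := by field_simp; rw [hc]; ring
      have e2 : y - t = c * (c⁻¹ * (y - t)) := by field_simp
      rw [e1]
      nth_rewrite 2 4 [e2]
      rw [rlKernel_mul hc0, rlKernel_mul hc0, hqd]
      ring
    rw [e]
    refine ⟨((hq.comp_mul_left' (inv_ne_zero hc0.ne')).comp_sub_left y).const_mul _, ?_⟩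
    rw [integral_const_mul, integral_sub_left_eq_self (fun t ↦ q (c⁻¹ * t)) volume y,
      Measure.integral_comp_mul_left, inv_inv, abs_of_pos hc0, smul_eq_mul,
      ← Real.rpow_natCast, ← Real.rpow_mul hc0.le,
      show 2 * H = (a - 1) * ((2 : ℕ) : ℝ) + 1 by rw [ha]; push_cast; ring, Real.rpow_add hc0,
      Real.rpow_one]
    ring
  rw [variogram]
  rcases lt_trichotomy (x : ℝ) y with h | h | h
  · have := main y x h
    rw [abs_sub_comm (x : ℝ)]
    have e : ∀ t : ℝ, (rlKernel a (x - t) - rlKernel a (y - t)) *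
        (rlKernel a (x - t) - rlKernel a (y - t)) =
        (rlKernel a (y - t) - rlKernel a (x - t)) *
        (rlKernel a (y - t) - rlKernel a (x - t)) := fun t ↦ by ring
    simpa only [e] using this
  · rw [h]
    simp [Real.zero_rpow (show 2 * H ≠ 0 by positivity)]
  · exact main x y h

/-- The cross variogram of the forward and the backward kernels is, up to a constant, that of
fractional Brownian motion. -/
lemma integral_forward_backward_kernel {H : ℝ} (hH0 : 0 < H) (x y : ℝ≥0) :
    Integrable (fun t ↦ (-rlKernel (H + 1 / 2) (t - x) - -rlKernel (H + 1 / 2) (t - y)) *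
        (rlKernel (H + 1 / 2) (x - t) - rlKernel (H + 1 / 2) (y - t))) ∧
      ∫ t, (-rlKernel (H + 1 / 2) (t - x) - -rlKernel (H + 1 / 2) (t - y)) *
        (rlKernel (H + 1 / 2) (x - t) - rlKernel (H + 1 / 2) (y - t)) =
      (1 / Real.Gamma (2 * H + 1)) * variogram H x y := by
  set a := H + 1 / 2 with ha
  have main : ∀ x y : ℝ, y < x →
      Integrable (fun t ↦ (-rlKernel a (t - x) - -rlKernel a (t - y)) *
        (rlKernel a (x - t) - rlKernel a (y - t))) ∧
      ∫ t, (-rlKernel a (t - x) - -rlKernel a (t - y)) *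
        (rlKernel a (x - t) - rlKernel a (y - t)) =
        (1 / Real.Gamma (2 * H + 1)) * |x - y| ^ (2 * H) := by
    intro x y hxy
    -- The forward factor vanishes for $t\le y$ and the backward one for $t\ge x$. In between one
    -- kernel of each survives, and their convolution is $k_{2H+1}(x-y)$.
    have e : (fun t ↦ (-rlKernel a (t - x) - -rlKernel a (t - y)) *
        (rlKernel a (x - t) - rlKernel a (y - t))) =
        fun t ↦ rlKernel a (x - t) * rlKernel a (t - y) := by
      ext t
      rcases le_or_gt t y with h1 | h1
      · rw [rlKernel_of_nonpos (x := t - x) (by linarith),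
          rlKernel_of_nonpos (x := t - y) (by linarith)]
        ring
      rw [rlKernel_of_nonpos (x := y - t) (by linarith)]
      rcases le_or_gt t x with h2 | h2
      · rw [rlKernel_of_nonpos (x := t - x) (by linarith)]
        ring
      · rw [rlKernel_of_nonpos (x := x - t) (by linarith)]
        ring
    have ha0 : 0 < a := by rw [ha]; positivity
    obtain ⟨h1, h2⟩ := integral_rlKernel_mul_rlKernel ha0 ha0 x y
    rw [e]
    refine ⟨h1, ?_⟩
    rw [h2, rlKernel_of_pos (by linarith), abs_of_pos (by linarith),
      show a + a - 1 = 2 * H by rw [ha]; ring, show a + a = 2 * H + 1 by rw [ha]; ring]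
    ring
  rw [variogram]
  rcases lt_trichotomy (x : ℝ) y with h | h | h
  · have := main y x h
    rw [abs_sub_comm (x : ℝ)]
    have e : ∀ t : ℝ, (-rlKernel a (t - x) - -rlKernel a (t - y)) *
        (rlKernel a (x - t) - rlKernel a (y - t)) =
        (-rlKernel a (t - y) - -rlKernel a (t - x)) *
        (rlKernel a (y - t) - rlKernel a (x - t)) := fun t ↦ by ring
    simpa only [e] using this
  · rw [h]
    simp [Real.zero_rpow (show 2 * H ≠ 0 by positivity)]
  · exact main x y h

lemma memLp_rlKernel_sub {a T : ℝ} (ha : 1 / 2 < a) (x : ℝ) :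
    MemLp (fun t ↦ rlKernel a (t - x)) 2 (volume.restrict (Set.Ioo 0 T)) := by
  have h := ((measurePreserving_sub_right (volume : Measure ℝ) x).restrict_preimage
    (measurableSet_Ioc (a := 0 - x) (b := T - x)))
  have e : (fun t : ℝ ↦ t - x) ⁻¹' Set.Ioc (0 - x) (T - x) = Set.Ioc 0 T := by
    ext t
    simp
  rw [e] at h
  exact ((memLp_rlKernel ha _ _).comp_measurePreserving h).mono_measure
    (Measure.restrict_mono Set.Ioo_subset_Ioc_self le_rfl)

/-! ### Fractional derivatives of step functions and the energy bound -/

namespace StepFunction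

variable {T : ℝ}

/-- The left-sided Riemann-Liouville derivative of order `1 - a` of a step function. -/
noncomputable def forward (a : ℝ) (f : StepFunction T) (t : ℝ) : ℝ :=
  f.comb fun x ↦ -rlKernel a (t - x)

/-- The right-sided Riemann-Liouville derivative of order `1 - a` of a step function. -/
noncomputable def backward (a : ℝ) (f : StepFunction T) (t : ℝ) : ℝ :=
  f.comb fun x ↦ rlKernel a (x - t)

@[fun_prop]
lemma measurable_forward (a : ℝ) (f : StepFunction T) : Measurable (f.forward a) := by
  unfold forward comb
  fun_prop

@[fun_prop]
lemma measurable_backward (a : ℝ) (f : StepFunction T) : Measurable (f.backward a) := by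
  unfold backward comb
  fun_prop

lemma forward_of_nonpos (a : ℝ) (f : StepFunction T) {t : ℝ} (ht : t ≤ 0) :
    f.forward a t = 0 := by
  unfold forward comb
  refine Finset.sum_eq_zero fun i _ ↦ ?_
  beta_reduce
  rw [rlKernel_of_nonpos, rlKernel_of_nonpos]
  · simp
  · linarith [(f.l i).2]
  · linarith [(f.r i).2]

lemma backward_of_le (a : ℝ) (f : StepFunction T) {t : ℝ} (ht : T ≤ t) :
    f.backward a t = 0 := by
  unfold backward comb
  refine Finset.sum_eq_zero fun i _ ↦ ?_
  beta_reduce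
  rw [rlKernel_of_nonpos, rlKernel_of_nonpos]
  · simp
  · linarith [f.l_le i]
  · linarith [f.r_le i]

lemma memLp_forward {a : ℝ} (ha : 1 / 2 < a) (f : StepFunction T) :
    MemLp (f.forward a) 2 (volume.restrict (Set.Ioo 0 T)) := by
  unfold forward comb
  exact memLp_finsetSum _ fun i _ ↦
    ((memLp_rlKernel_sub ha _).neg.sub (memLp_rlKernel_sub ha _).neg).const_mul _

section

variable {H : ℝ}

lemma integral_backward_sq (hH0 : 0 < H) (hH1 : H < 1) (f : StepFunction T) :
    MemLp (f.backward (H + 1 / 2)) 2 ∧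
    ∫ t, f.backward (H + 1 / 2) t ^ 2 =
      (∫ t, (rlKernel (H + 1 / 2) (t + 1) - rlKernel (H + 1 / 2) t) ^ 2) *
        f.energy (variogram H) := by
  have h := f.integral_comb_mul_comb fun x y ↦ integral_backward_kernel hH0 hH1 x y
  simp only [← sq] at h
  exact ⟨(memLp_two_iff_integrable_sq (by fun_prop)).2 h.1, h.2⟩

/-- The product is supported in $(0,T)$: the forward derivative vanishes before $0$ and the backward
one after $T$. Hence only the norm of the forward derivative on $(0,T)$ enters the final bound. -/
lemma integral_forward_mul_backward (hH0 : 0 < H) (f : StepFunction T) :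
    ∫ t in Set.Ioo 0 T, f.forward (H + 1 / 2) t * f.backward (H + 1 / 2) t =
      (1 / Real.Gamma (2 * H + 1)) * f.energy (variogram H) := by
  have h := f.integral_comb_mul_comb fun x y ↦ integral_forward_backward_kernel hH0 x y
  rw [← h.2]
  refine setIntegral_eq_integral_of_forall_compl_eq_zero fun t ht ↦ ?_
  rcases le_or_gt t 0 with h1 | h1
  · rw [forward_of_nonpos _ _ h1, zero_mul]
  · rw [backward_of_le _ _ (not_lt.1 fun h2 ↦ ht ⟨h1, h2⟩), mul_zero]

lemma integral_sq_integral {Ω : Type*} [MeasurableSpace Ω] {P : Measure Ω} {W : ℝ≥0 → Ω → ℝ}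
    (hH0 : 0 < H) (hW : IsFBM H W P) (f : StepFunction T) :
    MemLp (f.integral W) 2 P ∧ ∫ ω, f.integral W ω ^ 2 ∂P = f.energy (variogram H) := by
  have h := f.integral_comb_mul_comb (κ := 1) (d := variogram H) fun x y ↦ by
    simpa using hW.integral_increment_sq hH0 x y
  simp only [← sq, one_mul] at h
  refine ⟨?_, h.2⟩
  unfold integral
  exact memLp_finsetSum _ fun i _ ↦ ((hW.memLp _).sub (hW.memLp _)).const_mul _

/-- The constant in the bound of the energy by the fractional derivative. -/
noncomputable def _root_.FBM.energyConst (H : ℝ) : ℝ :=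
  (∫ t, (rlKernel (H + 1 / 2) (t + 1) - rlKernel (H + 1 / 2) t) ^ 2) *
    Real.Gamma (2 * H + 1) ^ 2

lemma _root_.FBM.energyConst_pos (hH0 : 0 < H) (hH1 : H < 1) : 0 < energyConst H := by
  have h1 := integral_rlKernel_increment_sq_pos (a := H + 1 / 2) (by linarith) (by linarith)
  have h2 := Real.Gamma_pos_of_pos (show 0 < 2 * H + 1 by linarith)
  unfold energyConst
  positivity

/-- The energy appears both as the pairing of the two derivatives and as the squared norm of the
backward one. Cauchy-Schwarz bounds the pairing, and the backward norm is absorbed. -/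
lemma energy_le (hH0 : 0 < H) (hH1 : H < 1) (f : StepFunction T) :
    f.energy (variogram H) ≤ energyConst H *
      ∫ t in Set.Ioo 0 T, f.forward (H + 1 / 2) t ^ 2 := by
  have hκ := integral_rlKernel_increment_sq_pos (a := H + 1 / 2) (by linarith) (by linarith)
  have hΓ := Real.Gamma_pos_of_pos (show 0 < 2 * H + 1 by linarith)
  obtain ⟨hb, hb'⟩ := integral_backward_sq hH0 hH1 f
  have hfb := integral_forward_mul_backward hH0 f
  have hf := memLp_forward (a := H + 1 / 2) (by linarith) f
  set κ := ∫ t, (rlKernel (H + 1 / 2) (t + 1) - rlKernel (H + 1 / 2) t) ^ 2 with hκd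
  set G := Real.Gamma (2 * H + 1) with hG
  set S := f.energy (variogram H) with hS
  have h1 : ∫ t in Set.Ioo 0 T, f.backward (H + 1 / 2) t ^ 2 ≤ κ * S := by
    rw [← hb']
    exact setIntegral_le_integral hb.integrable_sq (ae_of_all _ fun t ↦ sq_nonneg _)
  have hbr := hb.restrict (Set.Ioo 0 T)
  -- Young's inequality with weight $\kappa G$, chosen so that the backward term is at most
  -- $S/(2G)$, half of the left-hand side $S/G$.
  have h2 : ∫ t in Set.Ioo 0 T, f.forward (H + 1 / 2) t * f.backward (H + 1 / 2) t ≤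
      ∫ t in Set.Ioo 0 T, (κ * G / 2 * f.forward (H + 1 / 2) t ^ 2 +
        1 / (2 * (κ * G)) * f.backward (H + 1 / 2) t ^ 2) := by
    refine integral_mono (hf.integrable_mul hbr)
      ((hf.integrable_sq.const_mul _).add (hbr.integrable_sq.const_mul _)) fun t ↦ ?_
    have h3 := sq_nonneg (κ * G * f.forward (H + 1 / 2) t - f.backward (H + 1 / 2) t)
    have h4 : 0 < κ * G := by positivity
    simp only
    rw [← sub_nonneg]
    have e : κ * G / 2 * f.forward (H + 1 / 2) t ^ 2 +
        1 / (2 * (κ * G)) * f.backward (H + 1 / 2) t ^ 2 -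
        f.forward (H + 1 / 2) t * f.backward (H + 1 / 2) t =
        (κ * G * f.forward (H + 1 / 2) t - f.backward (H + 1 / 2) t) ^ 2 / (2 * (κ * G)) := by
      field_simp
      ring
    rw [e]
    positivity
  rw [integral_add (hf.integrable_sq.const_mul _) (hbr.integrable_sq.const_mul _),
    integral_const_mul, integral_const_mul, hfb] at h2
  have h5 : 1 / (2 * (κ * G)) * ∫ t in Set.Ioo 0 T, f.backward (H + 1 / 2) t ^ 2 ≤
      1 / (2 * G) * S := by
    calc _ ≤ 1 / (2 * (κ * G)) * (κ * S) := by gcongr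
      _ = _ := by field_simp
  have h6 : 1 / (2 * G) * S ≤ κ * G / 2 * ∫ t in Set.Ioo 0 T, f.forward (H + 1 / 2) t ^ 2 := by
    have : 1 / G * S = 1 / (2 * G) * S + 1 / (2 * G) * S := by field_simp; ring
    linarith
  have h7 := mul_le_mul_of_nonneg_left h6 (show 0 ≤ 2 * G by positivity)
  calc S = 2 * G * (1 / (2 * G) * S) := by field_simp
    _ ≤ _ := h7
    _ = _ := by rw [energyConst, ← hκd, ← hG]; ring

end

end StepFunction

/-! ### Density and approximation in the graph norm -/

/-- A function in `L²(0, T)` orthogonal to all shifted Riemann-Liouville kernels vanishes. -/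
lemma ae_eq_zero_of_orthogonal_rlKernel {T a : ℝ} (ha : 0 < a) (ha1 : a ≤ 1)
    {ψ : ℝ → ℝ} (hψ : IntegrableOn ψ (Set.Ioo 0 T))
    (h : ∀ l ∈ Set.Ioo 0 T, ∫ t in Set.Ioo 0 T, rlKernel a (t - l) * ψ t = 0) :
    ∀ᵐ t ∂volume.restrict (Set.Ioo 0 T), ψ t = 0 := by
  have hm := measurableSet_Ioo (a := (0 : ℝ)) (b := T)
  set w : ℝ → ℝ := (Set.Ioo 0 T).indicator ψ with hw
  have hwi : Integrable w := (integrable_indicator_iff hm).2 hψ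
  -- Time reversal turns the pairing with $k_a(\cdot-l)$ into the fractional integral of
  -- $\psi(T-\cdot)$ at $T-l$, to which injectivity applies.
  have key : ∀ᵐ x ∂volume.restrict (Set.Ioo 0 T), w (T - x) = 0 := by
    refine ae_eq_zero_of_rlConv ha ha1 (fun ξ hξ ↦ ?_)
      (hwi.comp_sub_left T).integrableOn (ae_restrict_of_forall_mem hm fun x hx ↦ ?_)
    · rw [hw, Set.indicator_of_notMem]
      exact fun h' ↦ absurd h'.2 (by linarith)
    · rw [rlConv, ← integral_sub_left_eq_self _ volume T]
      rw [← h (T - x) ⟨by linarith [hx.2], by linarith [hx.1]⟩, ← integral_indicator hm]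
      congr 1
      ext t
      rw [sub_sub_cancel, hw, Set.indicator_mul_right,
        show x - (T - t) = t - (T - x) by ring]
  rw [ae_restrict_iff' hm] at key ⊢
  filter_upwards [(Measure.measurePreserving_sub_left (volume : Measure ℝ)
    T).quasiMeasurePreserving.ae key] with t ht htT
  have := ht ⟨by linarith [htT.2], by linarith [htT.1]⟩
  rwa [sub_sub_cancel, hw, Set.indicator_of_mem htT] at this

namespace StepFunction

variable {T : ℝ}

lemma forward_one (f : StepFunction T) : f.forward 1 = f.toFun :=
  funext fun x ↦ (f.toFun_eq_comb x).symm

lemma memLp_toFun (f : StepFunction T) : MemLp f.toFun 2 (volume.restrict (Set.Ioo 0 T)) := by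
  rw [← forward_one]
  exact memLp_forward (by norm_num) f

lemma forward_sub (a : ℝ) (f h : StepFunction T) (t : ℝ) :
    (f.sub h).forward a t = f.forward a t - h.forward a t := comb_sub f h _

lemma backward_sub (a : ℝ) (f h : StepFunction T) (t : ℝ) :
    (f.sub h).backward a t = f.backward a t - h.backward a t := comb_sub f h _

lemma integral_sub {Ω : Type*} (W : ℝ≥0 → Ω → ℝ) (f h : StepFunction T) (ω : Ω) :
    (f.sub h).integral W ω = f.integral W ω - h.integral W ω :=
  comb_sub f h (W · ω)

lemma toFun_sub (f h : StepFunction T) (t : ℝ) :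
    (f.sub h).toFun t = f.toFun t - h.toFun t := by
  rw [← forward_one, ← forward_one, ← forward_one, forward_sub]

/-- The Riemann-Liouville derivatives of step functions, as elements of `L²(0, T)`. -/
def forwardSubmodule (a T : ℝ) : Submodule ℝ (Lp ℝ 2 (volume.restrict (Set.Ioo 0 T))) where
  carrier := {x | ∃ f : StepFunction T, x =ᵐ[volume.restrict (Set.Ioo 0 T)] f.forward a}
  zero_mem' := ⟨zero T, by
    filter_upwards [Lp.coeFn_zero ℝ 2 (volume.restrict (Set.Ioo 0 T))] with t ht
    rw [ht, forward, comb_zero]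
    rfl⟩
  add_mem' := by
    rintro x y ⟨f, hf⟩ ⟨h, hh⟩
    refine ⟨f.add h, ?_⟩
    filter_upwards [hf, hh, Lp.coeFn_add x y] with t h1 h2 h3
    rw [h3, Pi.add_apply, h1, h2, forward, forward, forward, comb_add]
  smul_mem' := by
    rintro c x ⟨f, hf⟩
    refine ⟨f.smul c, ?_⟩
    filter_upwards [hf, Lp.coeFn_smul c x] with t h1 h2
    rw [h2, Pi.smul_apply, h1, forward, forward, comb_smul, smul_eq_mul]

/-- The Riemann-Liouville derivatives of step functions are dense in `L²(0, T)`. -/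
lemma exists_forward_tendsto {a : ℝ} (ha : 1 / 2 < a) (ha1 : a ≤ 1)
    {φ : ℝ → ℝ} (hφ : MemLp φ 2 (volume.restrict (Set.Ioo 0 T))) :
    ∃ f : ℕ → StepFunction T, Tendsto (fun k ↦ eLpNorm (fun x ↦ (f k).forward a x - φ x) 2
      (volume.restrict (Set.Ioo 0 T))) atTop (𝓝 0) := by
  have hm := measurableSet_Ioo (a := (0 : ℝ)) (b := T)
  have hdense : (forwardSubmodule a T).topologicalClosure = ⊤ := by
    rw [Submodule.topologicalClosure_eq_top_iff, Submodule.eq_bot_iff]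
    intro ψ hψ
    rw [Submodule.mem_orthogonal] at hψ
    rw [Lp.eq_zero_iff_ae_eq_zero]
    refine ae_eq_zero_of_orthogonal_rlKernel (by linarith) ha1
      ((Lp.memLp ψ).integrable (by norm_num)) fun l hl ↦ ?_
    have hT : 0 < T := hl.1.trans hl.2
    -- The step function $\mathbf 1_{(l,T]}$: its end point $T$ contributes nothing before time $T$,
    -- so its derivative on $(0,T)$ is the single kernel $k_a(\cdot-l)$.
    let s : StepFunction T := single l.toNNReal T.toNNReal (Real.toNNReal_le_toNNReal hl.2.le)
      (Real.coe_toNNReal T hT.le).le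
    have h1 := hψ ((memLp_forward ha s).toLp _) ⟨s, MemLp.coeFn_toLp _⟩
    rw [L2.inner_def] at h1
    refine Eq.trans (integral_congr_ae ?_) h1
    filter_upwards [(memLp_forward ha s).coeFn_toLp, ae_restrict_mem hm] with t ht htT
    rw [ht, forward, comb_single, Real.coe_toNNReal T hT.le, Real.coe_toNNReal l hl.1.le,
      rlKernel_of_nonpos (x := t - T) (by linarith [htT.2])]
    simp [mul_comm]
  have h1 : hφ.toLp φ ∈ closure (forwardSubmodule a T : Set (Lp ℝ 2 _)) := by
    rw [← Submodule.topologicalClosure_coe, hdense]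
    trivial
  obtain ⟨x, hx, hlim⟩ := mem_closure_iff_seq_limit.1 h1
  choose f hf using hx
  refine ⟨f, ?_⟩
  rw [Lp.tendsto_Lp_iff_tendsto_eLpNorm'] at hlim
  refine hlim.congr fun k ↦ eLpNorm_congr_ae ?_
  filter_upwards [hf k, hφ.coeFn_toLp] with t h2 h3
  rw [Pi.sub_apply, h2, h3]

/-- The semigroup law on step functions. It recovers $f$ from its derivative when $H<1/2$, and
produces the derivative from $f$ when $H>1/2$. -/
lemma rlConv_forward {a b : ℝ} (ha : 0 < a) (hb : 0 < b) (f : StepFunction T) (x : ℝ) :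
    rlConv b (f.forward a) x = f.forward (b + a) x := by
  have hi : ∀ y : ℝ, Integrable fun ξ ↦ rlKernel b (x - ξ) * rlKernel a (ξ - y) := fun y ↦
    (integral_rlKernel_mul_rlKernel hb ha x y).1
  have e : ∀ ξ, rlKernel b (x - ξ) * f.forward a ξ =
      ∑ i, f.c i * (rlKernel b (x - ξ) * rlKernel a (ξ - f.l i) -
        rlKernel b (x - ξ) * rlKernel a (ξ - f.r i)) := fun ξ ↦ by
    rw [forward, comb, Finset.mul_sum]
    refine Finset.sum_congr rfl fun i _ ↦ ?_
    ring
  rw [rlConv]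
  simp only [e]
  have hd : ∀ i, Integrable fun ξ ↦ f.c i * (rlKernel b (x - ξ) * rlKernel a (ξ - f.l i) -
      rlKernel b (x - ξ) * rlKernel a (ξ - f.r i)) := fun i ↦ ((hi _).sub (hi _)).const_mul _
  rw [integral_finsetSum _ fun i _ ↦ hd i, forward, comb]
  refine Finset.sum_congr rfl fun i _ ↦ ?_
  rw [integral_const_mul, MeasureTheory.integral_sub (hi _) (hi _),
    (integral_rlKernel_mul_rlKernel hb ha x _).2, (integral_rlKernel_mul_rlKernel hb ha x _).2]
  ring

end StepFunction

lemma tendsto_rlConv {T b : ℝ} (hb : 0 < b) {u : ℕ → ℝ → ℝ} {v : ℝ → ℝ}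
    (hu0 : ∀ k, ∀ ξ ≤ 0, u k ξ = 0) (hv0 : ∀ ξ ≤ 0, v ξ = 0)
    (hu : ∀ k, MemLp (u k) 2 (volume.restrict (Set.Ioo 0 T)))
    (hv : MemLp v 2 (volume.restrict (Set.Ioo 0 T)))
    (h : Tendsto (fun k ↦ eLpNorm (fun x ↦ u k x - v x) 2
      (volume.restrict (Set.Ioo 0 T))) atTop (𝓝 0)) :
    Tendsto (fun k ↦ eLpNorm (fun x ↦ rlConv b (u k) x - rlConv b v x) 2
      (volume.restrict (Set.Ioo 0 T))) atTop (𝓝 0) := by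
  have hC := (lintegral_rlKernel_lt_top hb T).ne
  have h1 := ENNReal.Tendsto.const_mul h (Or.inr hC)
  rw [mul_zero] at h1
  refine tendsto_of_tendsto_of_tendsto_of_le_of_le tendsto_const_nhds h1 (fun k ↦ zero_le)
    fun k ↦ ?_
  have h2 := eLpNorm_rlConv_le (T := T) (a := b) (u := fun x ↦ u k x - v x)
    (fun ξ hξ ↦ by rw [hu0 k ξ hξ, hv0 ξ hξ, sub_zero]) ((hu k).1.sub hv.1)
  refine le_of_eq_of_le (eLpNorm_congr_ae ?_) h2
  filter_upwards [ae_integrable_rlConv hb (hu0 k) (hu k), ae_integrable_rlConv hb hv0 hv]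
    with x h3 h4
  simp only [rlConv, mul_sub]
  rw [integral_sub h3 h4]

/-- Approximation by step functions in the graph norm of the fractional derivative. -/
lemma HasRLDeriv.exists_tendsto {H T : ℝ} (hH0 : 0 < H) (hT : 0 < T)
    {g φ : ℝ → ℝ} (hg : MemLp g 2 (volume.restrict (Set.Ioo 0 T)))
    (h : HasRLDeriv T ((1 - 2 * H) / 2) g φ)
    (hφ : MemLp φ 2 (volume.restrict (Set.Ioo 0 T))) :
    ∃ f : ℕ → StepFunction T,
      Tendsto (fun k ↦ eLpNorm (fun x ↦ (f k).toFun x - g x) 2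
        (volume.restrict (Set.Ioo 0 T))) atTop (𝓝 0) ∧
      Tendsto (fun k ↦ eLpNorm (fun x ↦ (f k).forward (H + 1 / 2) x - φ x) 2
        (volume.restrict (Set.Ioo 0 T))) atTop (𝓝 0) := by
  have hm := measurableSet_Ioo (a := (0 : ℝ)) (b := T)
  have hind : ∀ u : ℝ → ℝ, ∀ ξ ≤ 0, (Set.Ioo 0 T).indicator u ξ = 0 := fun u ξ hξ ↦
    Set.indicator_of_notMem (fun h ↦ absurd h.1 hξ.not_gt) _
  have hindL : ∀ u : ℝ → ℝ, (Set.Ioo 0 T).indicator u =ᵐ[volume.restrict (Set.Ioo 0 T)] u :=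
    fun u ↦ indicator_ae_eq_restrict hm
  have hsub : ∀ {u v w : ℝ → ℝ}, v =ᵐ[volume.restrict (Set.Ioo 0 T)] w →
      eLpNorm (fun x ↦ u x - v x) 2 (volume.restrict (Set.Ioo 0 T)) =
        eLpNorm (fun x ↦ u x - w x) 2 (volume.restrict (Set.Ioo 0 T)) := fun hvw ↦
    eLpNorm_congr_ae (hvw.mono fun x hx ↦ by simp only [hx])
  rcases lt_trichotomy H (1 / 2) with hH | hH | hH
  -- For $H<1/2$ the derivative is unbounded, so $\varphi$ is approximated and fractional
  -- integration carries the convergence to $g$.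
  · obtain ⟨f, hf⟩ := StepFunction.exists_forward_tendsto (a := H + 1 / 2) (by linarith)
      (by linarith) hφ
    refine ⟨f, ?_, hf⟩
    have hβ : 0 < (1 - 2 * H) / 2 := by linarith
    have h1 := tendsto_rlConv hβ (u := fun k ↦ (f k).forward (H + 1 / 2)) (fun k ξ hξ ↦ (f k).forward_of_nonpos _ hξ) (hind φ)
      (fun k ↦ (f k).memLp_forward (by linarith)) (hφ.ae_eq (hindL φ).symm)
      (by simpa only [hsub (hindL φ)] using hf)
    have h2 : g =ᵐ[volume.restrict (Set.Ioo 0 T)]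
        rlConv ((1 - 2 * H) / 2) ((Set.Ioo 0 T).indicator φ) :=
      h.ae_eq_rlConv hT hβ (by linarith) hg hφ
    simp only [hsub h2]
    refine h1.congr fun k ↦ ?_
    congr 1
    ext x
    rw [StepFunction.rlConv_forward (by linarith) hβ, ← StepFunction.forward_one]
    congr 2
    ring
  · obtain ⟨f, hf⟩ := StepFunction.exists_forward_tendsto (a := 1) (by norm_num) le_rfl hg
    have hφg : φ =ᵐ[volume.restrict (Set.Ioo 0 T)] g := h.2.1 (by rw [hH]; norm_num)
    refine ⟨f, by simpa only [StepFunction.forward_one] using hf, ?_⟩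
    simp only [hsub hφg]
    rwa [hH, show (1 : ℝ) / 2 + 1 / 2 = 1 by norm_num]
  -- For $H>1/2$ the roles are exchanged: $\varphi$ is a fractional integral of $g$, so
  -- approximating $g$ suffices.
  · obtain ⟨f, hf⟩ := StepFunction.exists_forward_tendsto (a := 1) (by norm_num) le_rfl hg
    refine ⟨f, by simpa only [StepFunction.forward_one] using hf, ?_⟩
    have hb : 0 < -((1 - 2 * H) / 2) := by linarith
    have h1 := tendsto_rlConv hb (u := fun k ↦ (f k).forward 1) (fun k ξ hξ ↦ (f k).forward_of_nonpos _ hξ) (hind g)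
      (fun k ↦ (f k).memLp_forward (by norm_num)) (hg.ae_eq (hindL g).symm)
      (by simpa only [hsub (hindL g)] using hf)
    have h2 : φ =ᵐ[volume.restrict (Set.Ioo 0 T)]
        rlConv (-((1 - 2 * H) / 2)) ((Set.Ioo 0 T).indicator g) := by
      filter_upwards [h.2.2 (by linarith), ae_restrict_mem hm] with x hx hxT
      rw [hx, rlConv_indicator_eq_rlIntegral hxT]
    simp only [hsub h2]
    refine h1.congr fun k ↦ ?_
    congr 1
    ext x
    rw [StepFunction.rlConv_forward one_pos hb]
    congr 2
    ring

/-! ### Closability of the elementary integral -/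

lemma ae_eq_zero_of_forall_intervalIntegral {u : ℝ → ℝ} (hu : LocallyIntegrable u)
    (h : ∀ c d, c ≤ d → ∫ x in c..d, u x = 0) : ∀ᵐ x, u x = 0 := by
  filter_upwards [LocallyIntegrable.ae_hasDerivAt_integral hu] with x hx
  have h1 := hx (x - 1)
  have h2 : (fun y ↦ ∫ t in (x - 1)..y, u t) =ᶠ[𝓝 x] fun _ ↦ 0 := by
    filter_upwards [Ioi_mem_nhds (show x - 1 < x by linarith)] with y hy using h _ _ (le_of_lt hy)
  exact (h1.congr_of_eventuallyEq h2.symm).unique (hasDerivAt_const x (0 : ℝ))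

lemma norm_toLp_two_sq {α : Type*} [MeasurableSpace α] {μ : Measure α} {f : α → ℝ}
    (hf : MemLp f 2 μ) : ‖hf.toLp f‖ ^ 2 = ∫ x, f x ^ 2 ∂μ := by
  rw [← real_inner_self_eq_norm_sq, L2.inner_def]
  refine integral_congr_ae ?_
  filter_upwards [hf.coeFn_toLp] with x hx
  rw [hx]
  simp [sq]

lemma dist_toLp_two_sq {α : Type*} [MeasurableSpace α] {μ : Measure α} {f h : α → ℝ}
    (hf : MemLp f 2 μ) (hh : MemLp h 2 μ) :
    dist (hf.toLp f) (hh.toLp h) ^ 2 = ∫ x, (f x - h x) ^ 2 ∂μ := by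
  rw [dist_eq_norm, ← MemLp.toLp_sub, norm_toLp_two_sq]
  rfl

namespace StepFunction

variable {T : ℝ}

lemma intervalIntegrable_rlKernel {a : ℝ} (ha : 0 < a) (c d : ℝ) :
    IntervalIntegrable (rlKernel a) volume c d :=
  ⟨integrableOn_rlKernel ha c d, integrableOn_rlKernel ha d c⟩

/-- Fractional integration by parts against the indicator of an interval. -/
lemma intervalIntegral_backward {a : ℝ} (ha : 0 < a) (f : StepFunction T) (c d : ℝ) :
    ∫ t in c..d, f.backward a t =
      ∫ t in Set.Ioo 0 T, f.toFun t * (rlKernel a (t - c) - rlKernel a (t - d)) := by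
  have hk := intervalIntegrable_rlKernel ha
  have hk1 : ∀ x c d : ℝ, IntervalIntegrable (fun t ↦ rlKernel a (x - t)) volume c d :=
    fun x c d ↦ by
      have h := (hk (x - c) (x - d)).comp_sub_left x
      simpa using h
  have hk2 : ∀ x c d : ℝ, IntervalIntegrable (fun t ↦ rlKernel a (t - x)) volume c d :=
    fun x c d ↦ by
      have h := (hk (c - x) (d - x)).comp_sub_right x
      simpa using h
  have hP : ∀ x y, ∫ t in x..y, rlKernel a t =
      (∫ t in 0..y, rlKernel a t) - ∫ t in 0..x, rlKernel a t := fun x y ↦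
    (intervalIntegral.integral_interval_sub_left (hk 0 y) (hk 0 x)).symm
  -- Both sides are the same second difference of a primitive of the kernel.
  have key : ∀ l r : ℝ, ∫ t in c..d, (rlKernel a (r - t) - rlKernel a (l - t)) =
      ∫ t in l..r, (rlKernel a (t - c) - rlKernel a (t - d)) := fun l r ↦ by
    rw [intervalIntegral.integral_sub (hk1 _ _ _) (hk1 _ _ _),
      intervalIntegral.integral_sub (hk2 _ _ _) (hk2 _ _ _),
      intervalIntegral.integral_comp_sub_left (rlKernel a),
      intervalIntegral.integral_comp_sub_left (rlKernel a),
      intervalIntegral.integral_comp_sub_right (rlKernel a),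
      intervalIntegral.integral_comp_sub_right (rlKernel a), hP (r - d), hP (l - d) (l - c),
      hP (l - c) (r - c), hP (l - d) (r - d)]
    ring
  have hset : ∀ i, ∫ t in Set.Ioo 0 T, (Set.Ioc (f.l i : ℝ) (f.r i)).indicator (fun _ ↦ f.c i) t *
      (rlKernel a (t - c) - rlKernel a (t - d)) =
      f.c i * ∫ t in (f.l i : ℝ)..f.r i, (rlKernel a (t - c) - rlKernel a (t - d)) := fun i ↦ by
    have hlr : (f.l i : ℝ) ≤ f.r i := by exact_mod_cast f.l_le_r i
    rw [← integral_Ioc_eq_integral_Ioo, intervalIntegral.integral_of_le hlr, ← integral_const_mul,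
      ← integral_indicator measurableSet_Ioc, ← integral_indicator measurableSet_Ioc]
    congr 1
    ext t
    by_cases ht : t ∈ Set.Ioc (f.l i : ℝ) (f.r i)
    · have ht' : t ∈ Set.Ioc 0 T := ⟨(f.l i).2.trans_lt ht.1, ht.2.trans (f.r_le i)⟩
      simp [ht, ht']
    · simp [ht, Set.indicator]
  have hint : ∀ i, Integrable (fun t ↦ (Set.Ioc (f.l i : ℝ) (f.r i)).indicator
      (fun _ ↦ f.c i) t * (rlKernel a (t - c) - rlKernel a (t - d)))
      (volume.restrict (Set.Ioo 0 T)) := fun i ↦ by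
    have h1 : IntegrableOn (fun t ↦ rlKernel a (t - c) - rlKernel a (t - d)) (Set.Ioo 0 T) :=
      (((hk2 c 0 T).sub (hk2 d 0 T)).1).mono_set Set.Ioo_subset_Ioc_self
    refine ((h1.const_mul (f.c i)).indicator
      (measurableSet_Ioc (a := (f.l i : ℝ)) (b := f.r i))).congr (ae_of_all _ fun t ↦ ?_)
    by_cases ht : t ∈ Set.Ioc (f.l i : ℝ) (f.r i) <;> simp [ht]
  simp only [backward, comb, toFun, Finset.sum_mul]
  rw [intervalIntegral.integral_finsetSum fun i _ ↦ ((hk1 _ _ _).sub (hk1 _ _ _)).const_mul _,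
    integral_finsetSum _ fun i _ ↦ hint i]
  refine Finset.sum_congr rfl fun i _ ↦ ?_
  rw [intervalIntegral.integral_const_mul, key, hset]

section

variable {H : ℝ} {Ω : Type*} [MeasurableSpace Ω] {P : Measure Ω} {W : ℝ≥0 → Ω → ℝ}

/-- The elementary integral is closable from `L²(0, T)` to `L²(Ω)`. -/
lemma ae_eq_zero_of_tendsto (hH0 : 0 < H) (hH1 : H < 1) (hW : IsFBM H W P)
    (f : ℕ → StepFunction T) {X : Ω → ℝ} (hX : MemLp X 2 P)
    (hf : Tendsto (fun k ↦ eLpNorm (f k).toFun 2 (volume.restrict (Set.Ioo 0 T))) atTop (𝓝 0))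
    (hfX : Tendsto (fun k ↦ eLpNorm (fun ω ↦ (f k).integral W ω - X ω) 2 P) atTop (𝓝 0)) :
    ∀ᵐ ω ∂P, X ω = 0 := by
  set a := H + 1 / 2 with ha
  have ha2 : 1 / 2 < a := by linarith
  have hκ := integral_rlKernel_increment_sq_pos (a := a) ha2 (by linarith)
  set κ := ∫ t, (rlKernel a (t + 1) - rlKernel a t) ^ 2 with hκd
  have hJ : ∀ f : StepFunction T, MemLp (f.integral W) 2 P := fun f ↦
    (integral_sq_integral hH0 hW f).1
  have hB : ∀ f : StepFunction T, MemLp (f.backward a) 2 := fun f ↦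
    (integral_backward_sq hH0 hH1 f).1
  have hBJ : ∀ f : StepFunction T, ∫ t, f.backward a t ^ 2 = κ * ∫ ω, f.integral W ω ^ 2 ∂P :=
    fun f ↦ by rw [(integral_sq_integral hH0 hW f).2, (integral_backward_sq hH0 hH1 f).2]
  have hJX : Tendsto (fun k ↦ (hJ (f k)).toLp _) atTop (𝓝 (hX.toLp X)) :=
    (Lp.tendsto_Lp_iff_tendsto_eLpNorm'' _ (fun k ↦ hJ (f k)) X hX).2 hfX
  -- Up to the factor $\sqrt\kappa$, the backward derivative is an isometric copy of the elementary
  -- integral in $L^2(\mathbb R)$.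
  have hdist : ∀ k m, dist ((hB (f k)).toLp _) ((hB (f m)).toLp _) =
      √κ * dist ((hJ (f k)).toLp _) ((hJ (f m)).toLp _) := fun k m ↦ by
    rw [← Real.sqrt_sq (dist_nonneg (x := (hB (f k)).toLp _)),
      ← Real.sqrt_sq (dist_nonneg (x := (hJ (f k)).toLp _)), dist_toLp_two_sq, dist_toLp_two_sq,
      ← Real.sqrt_mul hκ.le]
    simp only [← backward_sub, ← integral_sub]
    rw [hBJ]
  have hcauchy : CauchySeq fun k ↦ (hB (f k)).toLp _ := by
    rw [cauchySeq_iff_tendsto_dist_atTop_0]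
    simp only [hdist]
    simpa using (cauchySeq_iff_tendsto_dist_atTop_0.1 hJX.cauchySeq).const_mul √κ
  obtain ⟨ψ, hψ⟩ := cauchySeq_tendsto_of_complete hcauchy
  have hf0 : Tendsto (fun k ↦ (f k).memLp_toFun.toLp _) atTop
      (𝓝 ((MemLp.zero : MemLp (0 : ℝ → ℝ) 2 (volume.restrict (Set.Ioo 0 T))).toLp _)) :=
    (Lp.tendsto_Lp_iff_tendsto_eLpNorm'' _ _ _ _).2 (by simpa using hf)
  have hψ0 : ψ = 0 := by
    rw [Lp.eq_zero_iff_ae_eq_zero]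
    refine ae_eq_zero_of_forall_intervalIntegral
      ((Lp.memLp ψ).locallyIntegrable (by norm_num)) fun c d hcd ↦ ?_
    have hcont : Tendsto (fun k ↦ ∫ t in c..d, (f k).backward a t) atTop
        (𝓝 (∫ t in c..d, ψ t)) := by
      have h1 : ∀ u : Lp ℝ 2 (volume : Measure ℝ), ∫ t in c..d, u t =
          inner ℝ (indicatorConstLp 2 (measurableSet_Ioc (a := c) (b := d))
            (by simp) (1 : ℝ)) u := fun u ↦ by
        rw [L2.inner_indicatorConstLp_one, intervalIntegral.integral_of_le hcd]
      have h2 : ∀ k, ∫ t in c..d, (f k).backward a t =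
          ∫ t in c..d, (hB (f k)).toLp _ t := fun k ↦
        intervalIntegral.integral_congr_ae ((hB (f k)).coeFn_toLp.mono fun t ht _ ↦ ht.symm)
      simp only [h2, h1]
      exact tendsto_const_nhds.inner hψ
    -- Integration by parts moves the fractional operator onto $\mathbf 1_{(c,d]}$, giving a fixed
    -- $L^2(0,T)$ function paired with $f_k\to0$.
    have hzero : Tendsto (fun k ↦ ∫ t in c..d, (f k).backward a t) atTop (𝓝 0) := by
      have hw : MemLp (fun t ↦ rlKernel a (t - c) - rlKernel a (t - d)) 2
          (volume.restrict (Set.Ioo 0 T)) :=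
        (memLp_rlKernel_sub ha2 c).sub (memLp_rlKernel_sub ha2 d)
      have h3 := hf0.inner (tendsto_const_nhds (x := hw.toLp _)) (𝕜 := ℝ)
      have h4 : inner ℝ ((MemLp.zero : MemLp (0 : ℝ → ℝ) 2
          (volume.restrict (Set.Ioo 0 T))).toLp _) (hw.toLp _) = 0 := by
        rw [MemLp.toLp_zero, inner_zero_left]
      rw [h4] at h3
      refine h3.congr fun k ↦ ?_
      rw [intervalIntegral_backward (by linarith), L2.inner_def]
      refine integral_congr_ae ?_
      filter_upwards [hw.coeFn_toLp, (f k).memLp_toFun.coeFn_toLp] with t h5 h6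
      rw [h5, h6]
      simp [mul_comm]
    exact tendsto_nhds_unique hcont hzero
  have hnorm : ∀ k, ‖(hJ (f k)).toLp _‖ ^ 2 = κ⁻¹ * ‖(hB (f k)).toLp _‖ ^ 2 := fun k ↦ by
    rw [norm_toLp_two_sq, norm_toLp_two_sq, hBJ, inv_mul_cancel_left₀ hκ.ne']
  have h1 : Tendsto (fun k ↦ ‖(hJ (f k)).toLp _‖ ^ 2) atTop (𝓝 (‖hX.toLp X‖ ^ 2)) :=
    hJX.norm.pow 2
  have h2 : Tendsto (fun k ↦ ‖(hJ (f k)).toLp _‖ ^ 2) atTop (𝓝 0) := by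
    simp only [hnorm]
    simpa [hψ0] using (hψ.norm.pow 2).const_mul κ⁻¹
  have h3 : hX.toLp X = 0 :=
    norm_eq_zero.1 ((pow_eq_zero_iff two_ne_zero).1 (tendsto_nhds_unique h1 h2))
  filter_upwards [hX.coeFn_toLp, (Lp.eq_zero_iff_ae_eq_zero).1 h3] with ω h4 h5
  rw [← h4, h5]
  rfl

end

end StepFunction

/-! ### Reflection, and uniqueness and existence of the Wiener integral -/

namespace StepFunction

variable {T : ℝ}

/-- The energy is a sum over a chosen representation. Its proportionality to the norm of the
backward derivative shows that only `comb` matters. -/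
lemma energy_congr {H : ℝ} (hH0 : 0 < H) (hH1 : H < 1) {f h : StepFunction T}
    (hfh : ∀ F, f.comb F = h.comb F) : f.energy (variogram H) = h.energy (variogram H) := by
  have hκ := integral_rlKernel_increment_sq_pos (a := H + 1 / 2) (by linarith) (by linarith)
  refine mul_left_cancel₀ hκ.ne' ?_
  rw [← (integral_backward_sq hH0 hH1 f).2, ← (integral_backward_sq hH0 hH1 h).2]
  simp only [backward, hfh]

lemma comb_reflect (f : StepFunction T) (F : ℝ≥0 → ℝ) :
    f.reflect.comb F = f.comb fun x ↦ -F (T.toNNReal - x) := by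
  change ∑ i : Fin f.n, f.c i * (F (T.toNNReal - f.l i) - F (T.toNNReal - f.r i)) = _
  refine Finset.sum_congr rfl fun i _ ↦ ?_
  ring

/-- Reflecting a difference and subtracting reflections yield the same combinations of increments,
so the Cauchy estimate survives reflection. -/
lemma energy_reflect_sub_reflect {H : ℝ} (hH0 : 0 < H) (hH1 : H < 1) (f h : StepFunction T) :
    (f.reflect.sub h.reflect).energy (variogram H) = (f.sub h).energy (variogram H) := by
  rw [← energy_reflect (f.sub h)]
  refine energy_congr hH0 hH1 fun F ↦ ?_
  rw [comb_sub, comb_reflect, comb_reflect, comb_reflect, comb_sub]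

end StepFunction

lemma tendsto_eLpNorm_sub_sub {α : Type*} [MeasurableSpace α] {μ : Measure α} {u v : ℕ → α → ℝ}
    {x y : α → ℝ} (hu : ∀ k, MemLp (u k) 2 μ) (hv : ∀ k, MemLp (v k) 2 μ) (hx : MemLp x 2 μ)
    (hy : MemLp y 2 μ) (h1 : Tendsto (fun k ↦ eLpNorm (fun t ↦ u k t - x t) 2 μ) atTop (𝓝 0))
    (h2 : Tendsto (fun k ↦ eLpNorm (fun t ↦ v k t - y t) 2 μ) atTop (𝓝 0)) :
    Tendsto (fun k ↦ eLpNorm (fun t ↦ (u k t - v k t) - (x t - y t)) 2 μ) atTop (𝓝 0) := by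
  have h3 := h1.add h2
  rw [add_zero] at h3
  refine tendsto_of_tendsto_of_tendsto_of_le_of_le tendsto_const_nhds h3 (fun k ↦ zero_le)
    fun k ↦ ?_
  refine le_of_eq_of_le ?_ (eLpNorm_sub_le (((hu k).sub hx).1) (((hv k).sub hy).1) one_le_two)
  congr 1
  ext t
  simp only [Pi.sub_apply]
  ring

section

variable {H T : ℝ} {Ω : Type*} [MeasurableSpace Ω] {P : Measure Ω} {W : ℝ≥0 → Ω → ℝ}

/-- The Wiener integral with respect to a fractional Brownian motion is unique. -/
lemma IsWienerIntegral.ae_eq (hH0 : 0 < H) (hH1 : H < 1) (hW : IsFBM H W P) {g : ℝ → ℝ}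
    {X Y : Ω → ℝ} (hX : IsWienerIntegral P W T g X) (hY : IsWienerIntegral P W T g Y) :
    X =ᵐ[P] Y := by
  obtain ⟨hg, hX2, f, hf, hfX⟩ := hX
  obtain ⟨-, hY2, h, hh, hhY⟩ := hY
  have hJ : ∀ f : StepFunction T, MemLp (f.integral W) 2 P := fun f ↦
    (f.integral_sq_integral hH0 hW).1
  have h1 := tendsto_eLpNorm_sub_sub (fun k ↦ (f k).memLp_toFun) (fun k ↦ (h k).memLp_toFun)
    hg hg hf hh
  have h2 := tendsto_eLpNorm_sub_sub (fun k ↦ hJ (f k)) (fun k ↦ hJ (h k)) hX2 hY2 hfX hhY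
  simp only [sub_self, sub_zero, ← StepFunction.toFun_sub] at h1
  simp only [← StepFunction.integral_sub] at h2
  filter_upwards [StepFunction.ae_eq_zero_of_tendsto hH0 hH1 hW _ (hX2.sub hY2) h1 h2] with ω hω
  exact sub_eq_zero.1 hω

/-- Existence and bound of the Wiener integral of a limit of step functions whose energies are
controlled by a convergent sequence in `L²`. -/
lemma exists_isWienerIntegral (hH0 : 0 < H) (hH1 : H < 1) (hW : IsFBM H W P) {α : Type*}
    [MeasurableSpace α] {μ : Measure α} {g : ℝ → ℝ}
    (hg : MemLp g 2 (volume.restrict (Set.Ioo 0 T))) {C : ℝ} (hC : 0 < C)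
    (f : ℕ → StepFunction T) {ψ : ℕ → α → ℝ} {φ : α → ℝ} (hψ : ∀ k, MemLp (ψ k) 2 μ)
    (hφ : MemLp φ 2 μ)
    (hf : Tendsto (fun k ↦ eLpNorm (fun x ↦ (f k).toFun x - g x) 2
      (volume.restrict (Set.Ioo 0 T))) atTop (𝓝 0))
    (hψφ : Tendsto (fun k ↦ eLpNorm (fun x ↦ ψ k x - φ x) 2 μ) atTop (𝓝 0))
    (h1 : ∀ k, (f k).energy (variogram H) ≤ C * ∫ x, ψ k x ^ 2 ∂μ)
    (h2 : ∀ k m, ((f k).sub (f m)).energy (variogram H) ≤ C * ∫ x, (ψ k x - ψ m x) ^ 2 ∂μ) :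
    (∃ X : Ω → ℝ, IsWienerIntegral P W T g X) ∧
      ∀ X : Ω → ℝ, IsWienerIntegral P W T g X → ∫ ω, X ω ^ 2 ∂P ≤ C * ∫ x, φ x ^ 2 ∂μ := by
  have hJ : ∀ f : StepFunction T, MemLp (f.integral W) 2 P := fun f ↦
    (f.integral_sq_integral hH0 hW).1
  have hJe : ∀ f : StepFunction T, ∫ ω, f.integral W ω ^ 2 ∂P = f.energy (variogram H) :=
    fun f ↦ (f.integral_sq_integral hH0 hW).2
  have hlim : Tendsto (fun k ↦ (hψ k).toLp _) atTop (𝓝 (hφ.toLp φ)) :=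
    (Lp.tendsto_Lp_iff_tendsto_eLpNorm'' _ hψ φ hφ).2 hψφ
  have hdist : ∀ k m, dist ((hJ (f k)).toLp _) ((hJ (f m)).toLp _) ≤
      √C * dist ((hψ k).toLp _) ((hψ m).toLp _) := fun k m ↦ by
    rw [← Real.sqrt_sq (dist_nonneg (x := (hJ (f k)).toLp _)),
      ← Real.sqrt_sq (dist_nonneg (x := (hψ k).toLp _)), dist_toLp_two_sq, dist_toLp_two_sq,
      ← Real.sqrt_mul hC.le]
    refine Real.sqrt_le_sqrt ?_
    simp only [← StepFunction.integral_sub]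
    rw [hJe]
    exact h2 k m
  have hcauchy : CauchySeq fun k ↦ (hJ (f k)).toLp _ := by
    rw [cauchySeq_iff_tendsto_dist_atTop_0]
    have h3 := (cauchySeq_iff_tendsto_dist_atTop_0.1 hlim.cauchySeq).const_mul √C
    rw [mul_zero] at h3
    exact squeeze_zero (fun _ ↦ dist_nonneg) (fun n ↦ hdist n.1 n.2) h3
  obtain ⟨Y, hY⟩ := cauchySeq_tendsto_of_complete hcauchy
  have hYW : IsWienerIntegral P W T g Y := by
    refine ⟨hg, Lp.memLp Y, f, hf, ?_⟩
    rw [← Lp.toLp_coeFn Y (Lp.memLp Y)] at hY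
    exact (Lp.tendsto_Lp_iff_tendsto_eLpNorm'' _ (fun k ↦ hJ (f k)) Y (Lp.memLp Y)).1 hY
  have hYb : ∫ ω, Y ω ^ 2 ∂P ≤ C * ∫ x, φ x ^ 2 ∂μ := by
    rw [← norm_toLp_two_sq (Lp.memLp Y), ← norm_toLp_two_sq hφ, Lp.toLp_coeFn]
    refine le_of_tendsto_of_tendsto' (hY.norm.pow 2) ((hlim.norm.pow 2).const_mul C) fun k ↦ ?_
    rw [norm_toLp_two_sq, norm_toLp_two_sq, hJe]
    exact h1 k
  refine ⟨⟨Y, hYW⟩, fun X hX ↦ ?_⟩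
  have hXY : (fun ω ↦ X ω ^ 2) =ᵐ[P] fun ω ↦ Y ω ^ 2 :=
    (hX.ae_eq hH0 hH1 hW hYW).mono fun ω hω ↦ by simp only [hω]
  rwa [integral_congr_ae hXY]

end

lemma measurePreserving_reflect (T : ℝ) : MeasurePreserving (fun r ↦ T - r)
    (volume.restrict (Set.Ioo 0 T)) (volume.restrict (Set.Ioo 0 T)) := by
  have h := (Measure.measurePreserving_sub_left (volume : Measure ℝ) T).restrict_preimage
    (measurableSet_Ioo (a := (0 : ℝ)) (b := T))
  simpa using h

end FBM

/-! ### The main theorem -/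

theorem lemma2p3 (H : ℝ) (hH0 : 0 < H) (hH1 : H < 1) :
    ∃ C : ℝ, 0 < C ∧
      ∀ (T : ℝ), 0 < T →
      ∀ (Ω : Type*) [MeasurableSpace Ω] (P : Measure Ω) [IsProbabilityMeasure P]
        (W : ℝ≥0 → Ω → ℝ), FBM.IsFBM H W P →
      ∀ (g φ : ℝ → ℝ), MemLp g 2 (volume.restrict (Set.Ioo 0 T)) →
        FBM.HasRLDeriv T ((1 - 2 * H) / 2) g φ →
        MemLp φ 2 (volume.restrict (Set.Ioo 0 T)) →
        ((∃ X : Ω → ℝ, FBM.IsWienerIntegral P W T g X) ∧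
          ∀ X : Ω → ℝ, FBM.IsWienerIntegral P W T g X →
            ∫ ω, X ω ^ 2 ∂P ≤ C * ∫ t in Set.Ioo 0 T, φ t ^ 2) ∧
        ((∃ X : Ω → ℝ, FBM.IsWienerIntegral P W T (fun r ↦ g (T - r)) X) ∧
          ∀ X : Ω → ℝ, FBM.IsWienerIntegral P W T (fun r ↦ g (T - r)) X →
            ∫ ω, X ω ^ 2 ∂P ≤ C * ∫ t in Set.Ioo 0 T, φ t ^ 2) := by
  refine ⟨FBM.energyConst H, FBM.energyConst_pos hH0 hH1, ?_⟩
  intro T hT Ω _ P _ W hW g φ hg h hφ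
  obtain ⟨f, hf, hfφ⟩ := h.exists_tendsto hH0 hT hg hφ
  have hψ : ∀ k, MemLp ((f k).forward (H + 1 / 2)) 2 (volume.restrict (Set.Ioo 0 T)) := fun k ↦
    (f k).memLp_forward (by linarith)
  have h1 : ∀ k, (f k).energy (FBM.variogram H) ≤ FBM.energyConst H *
      ∫ x in Set.Ioo 0 T, (f k).forward (H + 1 / 2) x ^ 2 := fun k ↦ (f k).energy_le hH0 hH1
  have h2 : ∀ k m, ((f k).sub (f m)).energy (FBM.variogram H) ≤ FBM.energyConst H *
      ∫ x in Set.Ioo 0 T, ((f k).forward (H + 1 / 2) x - (f m).forward (H + 1 / 2) x) ^ 2 :=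
    fun k m ↦ by
      simp only [← FBM.StepFunction.forward_sub]
      exact FBM.StepFunction.energy_le hH0 hH1 _
  have hT' := FBM.measurePreserving_reflect T
  -- For $g(T-\cdot)$ the step functions are reflected, but the controlling sequence remains the
  -- forward derivatives of the original $f_k$, since the energies agree.
  refine ⟨FBM.exists_isWienerIntegral hH0 hH1 hW hg (FBM.energyConst_pos hH0 hH1) f hψ hφ hf hfφ
    h1 h2, FBM.exists_isWienerIntegral hH0 hH1 hW (hg.comp_measurePreserving hT')
    (FBM.energyConst_pos hH0 hH1) (fun k ↦ (f k).reflect) hψ hφ ?_ hfφ (fun k ↦ ?_)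
    fun k m ↦ ?_⟩
  · refine hf.congr fun k ↦ ?_
    refine (eLpNorm_comp_measurePreserving ((f k).memLp_toFun.sub hg).1 hT').symm.trans
      (eLpNorm_congr_ae ?_)
    filter_upwards [ae_restrict_of_ae (f k).toFun_reflect] with x hx
    simp only [Function.comp_apply, hx, Pi.sub_apply]
  · rw [FBM.StepFunction.energy_reflect]
    exact h1 k
  · rw [FBM.StepFunction.energy_reflect_sub_reflect hH0 hH1]
    exact h2 k m
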